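/- Let $k$ be a field. For a commutative monoid $S$ write $T^S=\operatorname{Spec} k[t^S]$, where $k[t^S]$ is the monoid algebra. For a lattice $N$ (free abelian group of finite rank) put $M=\operatorname{Hom}(N,\mathbf Z)$; then $T^M$ is a torus over $k$. A triple $(N,\Sigma,\Gamma)$ consists of a lattice $N$, a nonempty finite fan $\Sigma$ of strictly convex rational polyhedral cones in $N_{\mathbf R}$ (closed under taking faces, any two cones meeting in a common face), and a family $\Gamma=(\Gamma_\sigma)_{\sigma\in\Sigma}$ of finitely generated subsemigroups (containing $0$) $\Gamma_\sigma\subset\sigma^\vee\cap M$ such that $\mathbf Z\Gamma_\sigma=M$, $\mathbf R_{\ge 0}\Gamma_\sigma=\sigma^\vee$ and, for each face $\tau$ of $\sigma$, $\Gamma_\tau=\Gamma_\sigma+M(\tau,\Gamma_\sigma)$, where $M(\tau,\Gamma_\sigma)$ is the group generated by $\Gamma_\sigma\cap\tau^\perp$. The toric variety $T_\Sigma^\Gamma$ over $k$ is obtained by gluing the charts $T^{\Gamma_\sigma}$, $\sigma\in\Sigma$, along the open subschemes $T^{\Gamma_{\sigma\cap\sigma'}}$. It contains $T^M=T^{\Gamma_{\{0\}}}$,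 and $T^M$ acts on it, on charts by $t^\gamma\mapsto t^\gamma\otimes t^\gamma$. Write $T_\Sigma$ for the toric variety of the triple $(N,\Sigma,(\sigma^\vee\cap M)_\sigma)$, and $n\colon T_\Sigma\to T_\Sigma^\Gamma$ for the morphism glued from the inclusions $\Gamma_\sigma\subset\sigma^\vee\cap M$. Let $(N,\Sigma,\Gamma)$ and $(N',\Sigma',\Gamma')$ be two triples, and let $\phi\colon T^{M'}\to T^{M}$ be a morphism of algebraic tori over $k$ (a homomorphism of group schemes). There is a unique homomorphism $\phi_*\colon N'\to N$ such that $\phi$ is given by $t^m\mapsto t^{\phi^*(m)}$, where $\phi^*\colon M\to M'$ is the dual of $\phi_*$. Call $\phi_*$ a *map of fans with attached semigroups* $(N',\Sigma',\Gamma')\to(N,\Sigma,\Gamma)$ if for each $\sigma'\in\Sigma'$ there is $\sigma\in\Sigma$ with $\phi^*(\Gamma_\sigma)\subset\Gamma'_{\sigma'}$. Call a morphism $f\colon T_{\Sigma'}^{\Gamma'}\to T_\Sigma^\Gamma$ over $k$ *equivariant with respect to* $\phi$ if $f(y\cdot x)=\phi(y)\cdot f(x)$ (as an identity of morphisms $T^{M'}\times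 T_{\Sigma'}^{\Gamma'}\to T_\Sigma^\Gamma$), and say that $f$ *extends* $\phi$ if its restriction to $T^{M'}$ is $\phi$ followed by the inclusion $T^M\subset T_\Sigma^\Gamma$. Then: 1. If $\phi_*$ is a map of fans with attached semigroups, there is a unique morphism $\bar\phi\colon T_{\Sigma'}^{\Gamma'}\to T_\Sigma^\Gamma$ whose restriction to $T^{\Gamma'_{\sigma'}}$, for all $\sigma'\in\Sigma'$ and $\sigma\in\Sigma$ with $\phi^*(\Gamma_\sigma)\subset\Gamma'_{\sigma'}$, is the morphism $T^{\Gamma'_{\sigma'}}\to T^{\Gamma_\sigma}\subset T_\Sigma^\Gamma$ given by $t^\gamma\mapsto t^{\phi^*(\gamma)}$. The morphism $\bar\phi$ extends $\phi$ and is equivariant with respect to $\phi$. 2. Conversely, if $f\colon T_{\Sigma'}^{\Gamma'}\to T_\Sigma^\Gamma$ extends $\phi$ and is equivariant with respect to $\phi$, then $\phi_*$ is a map of fans with attached semigroups and $f=\bar\phi$. 3. The morphisms $n\colon T_\Sigma\to T_\Sigma^\Gamma$ and $n'\colon T_{\Sigma'}\to T_{\Sigma'}^{\Gamma'}$ are normalizations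 (integral birational morphisms from normal integral schemes). For each $f$ as in 2 there is a unique morphism $\psi\colon T_{\Sigma'}\to T_\Sigma$ that extends $\phi$ and is equivariant with respect to $\phi$, and $n\circ\psi=f\circ n'$. -/

import Mathlib

universe u

open CategoryTheory AlgebraicGeometry TensorProduct

namespace ToricSemigroup

noncomputable section

/-! ## Fans with attached semigroups -/

section Combinatorics

variable {N : Type u} [AddCommGroup N]

/-- The real vector space `N_ℝ = ℝ ⊗ N` of a lattice `N`. -/
abbrev RealSpace (N : Type u) [AddCommGroup N] : Type u := ℝ ⊗[ℤ] N

/-- The dual lattice `M = Hom(N, ℤ)`. -/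
abbrev DualLattice (N : Type u) [AddCommGroup N] : Type u := Module.Dual ℤ N

/-- The pairing `⟨m, v⟩` of `m ∈ M` with `v ∈ N_ℝ`, as the linear form on `N_ℝ` given by `m`;
this is the embedding of `M` in `M_ℝ = Hom(N_ℝ, ℝ)`. -/
abbrev realForm (m : DualLattice N) : Module.Dual ℝ (RealSpace N) :=
  m.baseChange ℝ

/-- The dual cone `σ^∨ ⊆ M_ℝ` of a cone `σ ⊆ N_ℝ`. -/
def dualCone (σ : PointedCone ℝ (RealSpace N)) :
    PointedCone ℝ (Module.Dual ℝ (RealSpace N)) :=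
  PointedCone.dual (Module.Dual.eval ℝ (RealSpace N)) (σ : Set (RealSpace N))

/-- A (nonempty, finite) fan of strictly convex rational polyhedral cones in `N_ℝ`. -/
structure Fan (N : Type u) [AddCommGroup N] where
  cones : Set (PointedCone ℝ (RealSpace N))
  finite : cones.Finite
  nonempty : cones.Nonempty
  rational : ∀ σ ∈ cones, ∃ s : Finset N,
    σ = PointedCone.hull ℝ ((fun n : N ↦ (1 : ℝ) ⊗ₜ[ℤ] n) '' (s : Set N))
  strictlyConvex : ∀ σ ∈ cones, (σ : ConvexCone ℝ (RealSpace N)).Salient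
  face_mem : ∀ σ ∈ cones, ∀ τ : PointedCone ℝ (RealSpace N), τ.IsFaceOf σ → τ ∈ cones
  inter_face : ∀ σ ∈ cones, ∀ σ' ∈ cones, (σ ⊓ σ').IsFaceOf σ

/-- The elements of `M` that vanish on `τ`, that is, `M ∩ τ^⊥`. -/
def perp (τ : PointedCone ℝ (RealSpace N)) : Set (DualLattice N) :=
  {m | ∀ v ∈ τ, realForm m v = 0}

/-- The group `M(τ, Γ)` generated by `Γ ∩ τ^⊥`. -/
def faceLattice (τ : PointedCone ℝ (RealSpace N)) (Γ : AddSubmonoid (DualLattice N)) :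
    AddSubgroup (DualLattice N) :=
  AddSubgroup.closure ((Γ : Set (DualLattice N)) ∩ perp τ)

/-- A triple `(N, Σ, Γ)`: a fan `Σ` in `N_ℝ` with a family of finitely generated semigroups
`Γ_σ ⊆ M` such that `ℤ Γ_σ = M`, `ℝ_{≥0} Γ_σ = σ^∨` (so that `Γ_σ ⊆ σ^∨ ∩ M`) and
`Γ_τ = Γ_σ + M(τ, Γ_σ)` for each face `τ` of `σ ∈ Σ`. -/
structure FanWithSemigroups (N : Type u) [AddCommGroup N] extends Fan N where
  semigroup : cones → AddSubmonoid (DualLattice N)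
  fg : ∀ σ, (semigroup σ).FG
  generates : ∀ σ, AddSubgroup.closure (semigroup σ : Set (DualLattice N)) = ⊤
  hull_eq : ∀ σ : cones,
    PointedCone.hull ℝ (realForm '' (semigroup σ : Set (DualLattice N))) = dualCone σ.1
  face_eq : ∀ σ τ : cones, τ.1.IsFaceOf σ.1 →
    semigroup τ = semigroup σ ⊔ (faceLattice τ.1 (semigroup σ)).toAddSubmonoid

/-- Farkas' lemma over a linearly ordered commutative ring. -/
theorem farkas {R : Type*} [CommRing R] [LinearOrder R] [IsStrictOrderedRing R] {W : Type*}
    [AddCommGroup W] [Module R W] (n : ℕ) : ∀ (α : Fin n → Module.Dual R W) (γ : Module.Dual R W),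
    (∀ x, (∀ i, 0 ≤ α i x) → 0 ≤ γ x) →
    ∃ d : R, 0 < d ∧ ∃ c : Fin n → R, (∀ i, 0 ≤ c i) ∧ d • γ = ∑ i, c i • α i := by
  induction n with
  | zero =>
    intro α γ h
    refine ⟨1, one_pos, fun _ ↦ 0, fun i ↦ le_rfl, ?_⟩
    ext x
    have h1 := h x (fun i ↦ i.elim0)
    have h2 := h (-x) (fun i ↦ i.elim0)
    simp at h2 ⊢
    exact le_antisymm h2 h1
  | succ n ih =>
    intro α γ h
    by_cases hc : ∀ x, (∀ i : Fin n, 0 ≤ α i.castSucc x) → 0 ≤ γ x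
    · obtain ⟨d, hd, c, hc0, e⟩ := ih (fun i ↦ α i.castSucc) γ hc
      refine ⟨d, hd, Fin.snoc c 0, ?_, ?_⟩
      · intro i
        refine Fin.lastCases ?_ (fun j ↦ ?_) i <;> simp [hc0]
      · rw [Fin.sum_univ_castSucc, e]
        simp
    · push Not at hc
      obtain ⟨x₀, hx₀, hγ⟩ := hc
      have hl : α (Fin.last n) x₀ < 0 := by
        by_contra! hl
        refine absurd (h x₀ fun i ↦ ?_) (not_le.mpr hγ)
        refine Fin.lastCases hl (fun j ↦ hx₀ j) i
      set β := α (Fin.last n) with hβ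
      obtain ⟨d, hd, c, hc0, e⟩ := ih
        (fun i ↦ (-β x₀) • α i.castSucc + (α i.castSucc x₀) • β)
        ((-β x₀) • γ + (γ x₀) • β) (by
          intro x hx
          have := h ((-β x₀) • x + (β x) • x₀) (by
            intro i
            refine Fin.lastCases ?_ (fun j ↦ ?_) i
            · rw [← hβ]
              simp [mul_comm]
            · have := hx j
              simp at this ⊢
              linarith)
          simp at this ⊢
          linarith)
      refine ⟨d * (-β x₀), mul_pos hd (neg_pos.mpr hl), Fin.snoc (fun i ↦ c i * (-β x₀))
        (∑ i, c i * α i.castSucc x₀ - d * γ x₀), ?_, ?_⟩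
      · intro i
        refine Fin.lastCases ?_ (fun j ↦ ?_) i
        · simp only [Fin.snoc_last]
          have : 0 ≤ ∑ i, c i * α i.castSucc x₀ :=
            Finset.sum_nonneg fun i _ ↦ mul_nonneg (hc0 i) (hx₀ i)
          have := (mul_neg_of_pos_of_neg hd hγ).le
          linarith
        · simp only [Fin.snoc_castSucc]
          exact mul_nonneg (hc0 j) (neg_pos.mpr hl).le
      · rw [Fin.sum_univ_castSucc]
        simp only [Fin.snoc_castSucc, Fin.snoc_last, ← hβ]
        have e' : (d * (-β x₀)) • γ = ∑ i, c i • ((-β x₀) • α i.castSucc + (α i.castSucc x₀) • β)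
            - (d * γ x₀) • β := by
          rw [← e]; module
        have e2 : (∑ i, c i * α i.castSucc x₀ - d * γ x₀) • β =
            (∑ i, c i * α i.castSucc x₀) • β - (d * γ x₀) • β := by module
        rw [e', e2, Finset.sum_smul, ← add_sub_assoc, ← Finset.sum_add_distrib]
        congr 1
        refine Finset.sum_congr rfl fun i _ ↦ ?_
        module

/-- Farkas' lemma for a finite set of linear forms. -/
theorem farkas_finset {R : Type*} [CommRing R] [LinearOrder R] [IsStrictOrderedRing R] {W : Type*}
    [AddCommGroup W] [Module R W] (s : Finset (Module.Dual R W)) (γ : Module.Dual R W)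
    (h : ∀ x, (∀ a ∈ s, 0 ≤ a x) → 0 ≤ γ x) :
    ∃ d : R, 0 < d ∧ ∃ c : Module.Dual R W → R, (∀ a, 0 ≤ c a) ∧ d • γ = ∑ a ∈ s, c a • a := by
  classical
  let e := s.equivFin
  obtain ⟨d, hd, c, hc, he⟩ := farkas s.card (fun i ↦ (e.symm i).1) γ
    (fun x hx ↦ h x fun a ha ↦ by simpa using hx (e ⟨a, ha⟩))
  refine ⟨d, hd, fun a ↦ if ha : a ∈ s then c (e ⟨a, ha⟩) else 0, fun a ↦ ?_, ?_⟩
  · dsimp only; split_ifs <;> simp [hc]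
  · rw [he, ← Finset.sum_coe_sort s, ← e.sum_comp]
    refine Finset.sum_congr rfl fun a _ ↦ ?_
    simp

/-- A vector on which each linear form that is nonnegative on `s` is nonnegative lies in the cone
generated by `s`. -/
theorem mem_hull_of_forall_dual {V : Type*} [AddCommGroup V] [Module ℝ V] {s : Set V}
    (hs : s.Finite) (x : V) (h : ∀ u : Module.Dual ℝ V, (∀ v ∈ s, 0 ≤ u v) → 0 ≤ u x) :
    x ∈ PointedCone.hull ℝ s := by
  classical
  let p : Finset (Module.Dual ℝ (Module.Dual ℝ V)) := hs.toFinset.image (Module.Dual.eval ℝ V)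
  obtain ⟨d, hd, c, hc, he⟩ := farkas_finset p (Module.Dual.eval ℝ V x) (fun u hu ↦ h u fun v hv ↦
    hu _ (Finset.mem_image_of_mem _ (hs.mem_toFinset.mpr hv)))
  rw [Finset.sum_image fun a _ b _ hab ↦ Module.eval_apply_injective ℝ hab] at he
  have he' : d • x = ∑ v ∈ hs.toFinset, c (Module.Dual.eval ℝ V v) • v := by
    apply Module.eval_apply_injective (V := V) ℝ
    simpa using he
  have : x = d⁻¹ • ∑ v ∈ hs.toFinset, c (Module.Dual.eval ℝ V v) • v := by
    rw [← he', smul_smul, inv_mul_cancel₀ hd.ne', one_smul]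
  rw [this]
  refine PointedCone.smul_mem _ (inv_nonneg.mpr hd.le) (Submodule.sum_mem _ fun v hv ↦ ?_)
  exact PointedCone.smul_mem _ (hc _) (Submodule.subset_span (hs.mem_toFinset.mp hv))

namespace FanWithSemigroups

variable (X : FanWithSemigroups N)

theorem nonneg_of_mem {σ : X.cones} {m : DualLattice N} (hm : m ∈ X.semigroup σ)
    {v : RealSpace N} (hv : v ∈ σ.1) : 0 ≤ realForm m v := by
  have : realForm m ∈ dualCone σ.1 := by
    rw [← X.hull_eq]
    exact Submodule.subset_span ⟨m, hm, rfl⟩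
  exact this hv

/-- `σ` is the dual of `Γ_σ`. -/
theorem mem_cone_of_nonneg (σ : X.cones) (x : RealSpace N)
    (hx : ∀ m ∈ X.semigroup σ, 0 ≤ realForm m x) : x ∈ σ.1 := by
  obtain ⟨s, hs⟩ := X.rational σ.1 σ.2
  rw [hs]
  refine mem_hull_of_forall_dual (s.finite_toSet.image _) x fun u hu ↦ ?_
  have hu' : u ∈ dualCone σ.1 := by
    rw [dualCone, hs, PointedCone.dual_hull]
    exact fun v hv ↦ hu v hv
  rw [← X.hull_eq] at hu'
  clear hu
  induction hu' using Submodule.span_induction with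
  | mem y hy => obtain ⟨m, hm, rfl⟩ := hy; exact hx m hm
  | zero => simp
  | add a b _ _ ha hb => exact add_nonneg ha hb
  | smul a y _ hy => exact mul_nonneg a.2 hy

/-- A face `τ` of `σ` is cut out of `σ` by `Γ_σ ∩ τ^⊥`. -/
theorem mem_face (σ : X.cones) {τ : PointedCone ℝ (RealSpace N)} (hτ : τ.IsFaceOf σ.1)
    {x : RealSpace N} (hxσ : x ∈ σ.1)
    (hx : ∀ m ∈ X.semigroup σ, m ∈ perp τ → realForm m x = 0) : x ∈ τ := by
  classical
  obtain ⟨s, hs⟩ := X.rational σ.1 σ.2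
  set S : Set (RealSpace N) := (fun n : N ↦ (1 : ℝ) ⊗ₜ[ℤ] n) '' (s : Set N) with hS
  have hSf : S.Finite := s.finite_toSet.image _
  have hSσ : ∀ v ∈ S, v ∈ σ.1 := fun v hv ↦ by rw [hs]; exact Submodule.subset_span hv
  let w : RealSpace N := ∑ v ∈ hSf.toFinset with v ∈ τ, v
  have hw : w ∈ τ := Submodule.sum_mem _ fun v hv ↦ (Finset.mem_filter.mp hv).2
  have key : -x ∈ PointedCone.hull ℝ (insert (-w) S) := by
    refine mem_hull_of_forall_dual (hSf.insert _) (-x) fun u hu ↦ ?_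
    have hu0 : ∀ v ∈ S, 0 ≤ u v := fun v hv ↦ hu v (Set.mem_insert_of_mem _ hv)
    have huw : u w ≤ 0 := by simpa using hu (-w) (Set.mem_insert _ _)
    have huσ : u ∈ dualCone σ.1 := by
      rw [dualCone, hs, PointedCone.dual_hull]
      exact fun v hv ↦ hu0 v hv
    have huv : ∀ v ∈ S, v ∈ τ → u v = 0 := by
      have h1 : ∀ v ∈ hSf.toFinset.filter (· ∈ τ), 0 ≤ u v := fun v hv ↦
        hu0 v (hSf.mem_toFinset.mp (Finset.mem_filter.mp hv).1)
      have h2 : ∑ v ∈ hSf.toFinset with v ∈ τ, u v = 0 :=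
        le_antisymm (by simpa [w] using huw) (Finset.sum_nonneg h1)
      intro v hv hvτ
      exact (Finset.sum_eq_zero_iff_of_nonneg h1).mp h2 v
        (Finset.mem_filter.mpr ⟨hSf.mem_toFinset.mpr hv, hvτ⟩)
    have huτ : ∀ y ∈ τ, u y = 0 := by
      intro y hy
      have hyσ := hτ.le hy
      rw [hs] at hyσ
      induction hyσ using Submodule.span_induction with
      | mem y h => exact huv y h hy
      | zero => simp
      | add a b ha hb iha ihb =>
        rw [← PointedCone.hull, ← hs] at ha hb
        rw [map_add, iha (hτ.mem_of_add_mem_left ha hb hy),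
          ihb (hτ.mem_of_add_mem_right ha hb hy), add_zero]
      | smul a y h ih =>
        rcases a.2.eq_or_lt with h0 | h0
        · have : a = 0 := Subtype.ext h0.symm
          simp [this]
        · have hy' : y ∈ τ := by
            have := PointedCone.smul_mem τ (inv_nonneg.mpr a.2) hy
            rwa [← Nonneg.coe_smul, smul_smul, inv_mul_cancel₀ h0.ne', one_smul] at this
          rw [LinearMap.map_smul_of_tower, ih hy', smul_zero]
    have hux : (∀ y ∈ σ.1, 0 ≤ u y) ∧ ((∀ y ∈ τ, u y = 0) → u x = 0) := by
      rw [← X.hull_eq] at huσ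
      clear huτ huv huw hu0 hu
      induction huσ using Submodule.span_induction with
      | mem y hy =>
        obtain ⟨m, hm, rfl⟩ := hy
        exact ⟨fun y hy ↦ X.nonneg_of_mem hm hy, fun h ↦ hx m hm h⟩
      | zero => simp
      | add a b _ _ ha hb =>
        refine ⟨fun y hy ↦ add_nonneg (ha.1 y hy) (hb.1 y hy), fun h ↦ ?_⟩
        have h1 : ∀ y ∈ τ, a y = 0 ∧ b y = 0 := fun y hy ↦
          (add_eq_zero_iff_of_nonneg (ha.1 y (hτ.le hy)) (hb.1 y (hτ.le hy))).mp (h y hy)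
        simp [ha.2 fun y hy ↦ (h1 y hy).1, hb.2 fun y hy ↦ (h1 y hy).2]
      | smul a y _ ih =>
        refine ⟨fun z hz ↦ mul_nonneg a.2 (ih.1 z hz), fun h ↦ ?_⟩
        rcases a.2.eq_or_lt with h0 | h0
        · have : a = 0 := Subtype.ext h0.symm
          simp [this]
        · have : ∀ z ∈ τ, y z = 0 := fun z hz ↦ by
            have := h z hz
            exact (mul_eq_zero.mp this).resolve_left h0.ne'
          have h2 := ih.2 this
          exact mul_eq_zero_of_right _ h2
    rw [map_neg, hux.2 huτ, neg_zero]
  obtain ⟨a, z, hz, e⟩ := Submodule.mem_span_insert.mp key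
  have hzσ : z ∈ σ.1 := by rw [hs]; exact hz
  have e' : x + z = a.1 • w := by
    have : -x = -(a.1 • w) + z := by rw [e, ← smul_neg]; rfl
    have h3 : x = a.1 • w - z := by rw [← neg_neg x, this]; abel
    rw [h3]; abel
  refine hτ.mem_of_add_mem_left hxσ hzσ ?_
  rw [e']
  exact PointedCone.smul_mem _ a.2 hw

theorem realForm_zero : realForm (0 : DualLattice N) = 0 := map_zero (Module.Dual.baseChange ℝ)

theorem realForm_add (a b : DualLattice N) : realForm (a + b) = realForm a + realForm b :=
  map_add (Module.Dual.baseChange ℝ) a b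

theorem realForm_neg (a : DualLattice N) : realForm (-a) = -realForm a :=
  map_neg (Module.Dual.baseChange ℝ) a

theorem realForm_nsmul (n : ℕ) (a : DualLattice N) : realForm (n • a) = n • realForm a :=
  map_nsmul (Module.Dual.baseChange ℝ) n a

theorem realForm_one_tmul (m : DualLattice N) (ν : N) :
    realForm m ((1 : ℝ) ⊗ₜ[ℤ] ν) = (m ν : ℝ) := by simp

theorem exists_nsmul_mem_closure (s : Finset (DualLattice N)) (m : DualLattice N)
    (h : ∀ ν : N, (∀ a ∈ s, 0 ≤ a ν) → 0 ≤ m ν) :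
    ∃ d : ℕ, 0 < d ∧ d • m ∈ AddSubmonoid.closure (s : Set (DualLattice N)) := by
  obtain ⟨d, hd, c, hc, he⟩ := farkas_finset s m h
  lift d to ℕ using hd.le
  refine ⟨d, by exact_mod_cast hd, ?_⟩
  rw [← natCast_zsmul, he]
  refine AddSubmonoid.sum_mem _ fun a ha ↦ ?_
  obtain ⟨n, hn⟩ := Int.eq_ofNat_of_zero_le (hc a)
  rw [hn, natCast_zsmul]
  exact AddSubmonoid.nsmul_mem _ (AddSubmonoid.subset_closure ha) n

/-- Elements of `σ^∨ ∩ M` have a multiple in `Γ_σ`. -/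
theorem exists_nsmul_mem (σ : X.cones) (m : DualLattice N) (hm : ∀ v ∈ σ.1, 0 ≤ realForm m v) :
    ∃ d : ℕ, 0 < d ∧ d • m ∈ X.semigroup σ := by
  obtain ⟨s, hs⟩ := X.fg σ
  rw [← hs]
  refine exists_nsmul_mem_closure s m fun ν hν ↦ ?_
  have h1 : (1 : ℝ) ⊗ₜ[ℤ] ν ∈ σ.1 := by
    refine X.mem_cone_of_nonneg σ _ fun a ha ↦ ?_
    rw [realForm_one_tmul]
    rw [← hs] at ha
    have : 0 ≤ a ν := by
      induction ha using AddSubmonoid.closure_induction with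
      | mem a ha => exact hν a ha
      | zero => simp
      | add a b _ _ ha hb => exact add_nonneg ha hb
    exact_mod_cast this
  have h2 := hm _ h1
  rw [realForm_one_tmul] at h2
  exact_mod_cast h2

theorem perp_of_add {σ : X.cones} {τ : PointedCone ℝ (RealSpace N)} (hτ : τ ≤ σ.1)
    {a b : DualLattice N} (ha : a ∈ X.semigroup σ) (hb : b ∈ X.semigroup σ)
    (h : a + b ∈ perp τ) : a ∈ perp τ ∧ b ∈ perp τ := by
  have : ∀ v ∈ τ, realForm a v = 0 ∧ realForm b v = 0 := fun v hv ↦ by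
    have h1 := h v hv
    rw [realForm_add, LinearMap.add_apply] at h1
    exact (add_eq_zero_iff_of_nonneg (X.nonneg_of_mem ha (hτ hv))
      (X.nonneg_of_mem hb (hτ hv))).mp h1
  exact ⟨fun v hv ↦ (this v hv).1, fun v hv ↦ (this v hv).2⟩

theorem zero_mem_perp (τ : PointedCone ℝ (RealSpace N)) : (0 : DualLattice N) ∈ perp τ :=
  fun v _ ↦ by simp

theorem add_mem_perp {τ : PointedCone ℝ (RealSpace N)} {a b : DualLattice N} (ha : a ∈ perp τ)
    (hb : b ∈ perp τ) : a + b ∈ perp τ := fun v hv ↦ by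
  have h1 := ha v hv
  have h2 := hb v hv
  rw [realForm_add, LinearMap.add_apply, h1, h2, add_zero]

theorem neg_mem_perp {τ : PointedCone ℝ (RealSpace N)} {a : DualLattice N} (ha : a ∈ perp τ) :
    -a ∈ perp τ := fun v hv ↦ by
  have h1 := ha v hv
  rw [realForm_neg, LinearMap.neg_apply, h1, neg_zero]

/-- `a ∈ Γ_σ ∩ τ^⊥` such that `Γ_τ` is the localization `Γ_σ + ℕ (-a)`. -/
structure IsFaceElement (σ : X.cones) (τ : PointedCone ℝ (RealSpace N)) (a : DualLattice N) :
    Prop where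
  mem : a ∈ X.semigroup σ
  mem_perp : a ∈ perp τ
  exists_add : ∀ γ ∈ X.semigroup σ, γ ∈ perp τ →
    ∃ (n : ℕ) (γ' : DualLattice N), γ' ∈ X.semigroup σ ∧ γ + γ' = n • a

theorem exists_isFaceElement (σ : X.cones) {τ : PointedCone ℝ (RealSpace N)} (hτ : τ ≤ σ.1) :
    ∃ a, X.IsFaceElement σ τ a := by
  classical
  obtain ⟨s, hs⟩ := X.fg σ
  have hsσ : ∀ g ∈ s, g ∈ X.semigroup σ := fun g hg ↦ by
    rw [← hs]; exact AddSubmonoid.subset_closure hg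
  refine ⟨∑ g ∈ s with g ∈ perp τ, g, ?_, ?_, ?_⟩
  · exact AddSubmonoid.sum_mem _ fun g hg ↦ hsσ g (Finset.mem_filter.mp hg).1
  · exact Finset.sum_induction _ (· ∈ perp τ) (fun _ _ ↦ add_mem_perp) (zero_mem_perp τ)
      fun g hg ↦ (Finset.mem_filter.mp hg).2
  · intro γ hγ
    rw [← hs] at hγ
    induction hγ using AddSubmonoid.closure_induction with
    | mem g hg =>
      intro hgτ
      refine ⟨1, ∑ x ∈ (s.filter (· ∈ perp τ)).erase g, x, ?_, ?_⟩
      · exact AddSubmonoid.sum_mem _ fun x hx ↦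
          hsσ x (Finset.mem_filter.mp (Finset.mem_of_mem_erase hx)).1
      · rw [one_smul]
        exact Finset.add_sum_erase _ (fun x ↦ x) (Finset.mem_filter.mpr ⟨hg, hgτ⟩)
    | zero => exact fun _ ↦ ⟨0, 0, zero_mem _, by simp⟩
    | add x y hx hy ihx ihy =>
      intro h
      rw [hs] at hx hy
      obtain ⟨hxτ, hyτ⟩ := X.perp_of_add hτ hx hy h
      obtain ⟨n, x', hx', ex⟩ := ihx hxτ
      obtain ⟨n', y', hy', ey⟩ := ihy hyτ
      refine ⟨n + n', x' + y', add_mem hx' hy', ?_⟩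
      rw [add_smul, ← ex, ← ey]
      abel

theorem semigroup_mono {σ τ : X.cones} (h : τ ≤ σ) : X.semigroup σ ≤ X.semigroup τ := by
  have h' : τ.1.IsFaceOf σ.1 := by
    have := X.inter_face σ.1 σ.2 τ.1 τ.2
    rwa [inf_eq_right.mpr (show τ.1 ≤ σ.1 from h)] at this
  rw [X.face_eq σ τ h']
  exact le_sup_left

theorem isFaceOf_of_le {σ τ : X.cones} (h : τ ≤ σ) : τ.1.IsFaceOf σ.1 := by
  have := X.inter_face σ.1 σ.2 τ.1 τ.2
  rwa [inf_eq_right.mpr (show τ.1 ≤ σ.1 from h)] at this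

theorem IsFaceElement.neg_mem {σ τ : X.cones} (h : τ ≤ σ) {a : DualLattice N}
    (ha : X.IsFaceElement σ τ.1 a) : -a ∈ X.semigroup τ := by
  rw [X.face_eq σ τ (X.isFaceOf_of_le h)]
  refine (le_sup_right : _ ≤ X.semigroup σ ⊔ _) ?_
  exact (AddSubgroup.closure _).neg_mem (AddSubgroup.subset_closure ⟨ha.mem, ha.mem_perp⟩)

theorem IsFaceElement.exists_add_mem {σ τ : X.cones} (h : τ ≤ σ) {a : DualLattice N}
    (ha : X.IsFaceElement σ τ.1 a) {m : DualLattice N} (hm : m ∈ X.semigroup τ) :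
    ∃ n : ℕ, m + n • a ∈ X.semigroup σ := by
  rw [X.face_eq σ τ (X.isFaceOf_of_le h)] at hm
  obtain ⟨x, hx, y, hy, rfl⟩ := AddSubmonoid.mem_sup.mp hm
  have : ∃ n : ℕ, y + n • a ∈ X.semigroup σ ∧ -y + n • a ∈ X.semigroup σ := by
    clear hm
    change y ∈ AddSubgroup.closure _ at hy
    induction hy using AddSubgroup.closure_induction with
    | mem y hy =>
      obtain ⟨n, y', hy', e⟩ := ha.exists_add y hy.1 hy.2
      refine ⟨n, add_mem hy.1 (nsmul_mem ha.mem n), ?_⟩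
      rwa [← e, neg_add_cancel_left]
    | zero => exact ⟨0, by simp⟩
    | add y z _ _ ihy ihz =>
      obtain ⟨n, h1, h2⟩ := ihy
      obtain ⟨n', h3, h4⟩ := ihz
      refine ⟨n + n', ?_, ?_⟩
      · convert add_mem h1 h3 using 1
        rw [add_smul]; abel
      · convert add_mem h2 h4 using 1
        rw [add_smul]; abel
    | neg y _ ih =>
      obtain ⟨n, h1, h2⟩ := ih
      exact ⟨n, h2, by rwa [neg_neg]⟩
  obtain ⟨n, hn, -⟩ := this
  exact ⟨n, by rw [add_assoc]; exact add_mem hx hn⟩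

/-- The combinatorial form of `U_i ∩ U_j = U_{i ∩ j}` inside the chart of `k`. -/
theorem exists_nsmul_add_eq {i j k : X.cones} (hi : i ≤ k) (hj : j ≤ k) {a b c : DualLattice N}
    (ha : X.IsFaceElement k i.1 a) (hb : X.IsFaceElement k j.1 b)
    (hc : c ∈ perp (i.1 ⊓ j.1)) :
    ∃ (n d : ℕ) (γ : DualLattice N), 0 < d ∧ γ ∈ X.semigroup k ∧ n • (a + b) = d • c + γ := by
  classical
  obtain ⟨s, hs⟩ := X.fg k
  obtain ⟨d, hd, h⟩ := exists_nsmul_mem_closure (insert (-(a + b)) s) (-c) (by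
    intro ν hν
    have hνs : ∀ m ∈ X.semigroup k, 0 ≤ m ν := by
      intro m hm
      rw [← hs] at hm
      induction hm using AddSubmonoid.closure_induction with
      | mem a ha => exact hν a (Finset.mem_insert_of_mem ha)
      | zero => simp
      | add a b _ _ ha hb => exact add_nonneg ha hb
    have hνk : (1 : ℝ) ⊗ₜ[ℤ] ν ∈ k.1 := X.mem_cone_of_nonneg k _ fun m hm ↦ by
      rw [realForm_one_tmul]
      exact_mod_cast hνs m hm
    have hab : a ν + b ν ≤ 0 := by
      have := hν _ (Finset.mem_insert_self _ _)
      rw [LinearMap.neg_apply, LinearMap.add_apply] at this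
      linarith
    have ha0 := hνs a ha.mem
    have hb0 := hνs b hb.mem
    have aux : ∀ (l : X.cones) (_ : l ≤ k) (e : DualLattice N) (_ : X.IsFaceElement k l.1 e)
        (_ : e ν = 0), (1 : ℝ) ⊗ₜ[ℤ] ν ∈ l.1 := by
      intro l hl e he he0
      refine X.mem_face k (X.isFaceOf_of_le hl) hνk fun m hm hml ↦ ?_
      obtain ⟨n, m', hm', e'⟩ := he.exists_add m hm hml
      have h1 : m ν + m' ν = 0 := by
        rw [← LinearMap.add_apply, e', LinearMap.smul_apply, he0, smul_zero]
      have h2 := hνs m hm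
      have h3 := hνs m' hm'
      rw [realForm_one_tmul, show m ν = 0 by linarith, Int.cast_zero]
    have h4 := hc _ ⟨aux i hi a ha (by linarith), aux j hj b hb (by linarith)⟩
    rw [realForm_one_tmul] at h4
    have h5 : c ν = 0 := by exact_mod_cast h4
    simp [h5])
  rw [Finset.coe_insert, Set.insert_eq, AddSubmonoid.closure_union, hs] at h
  obtain ⟨x, hx, y, hy, e⟩ := AddSubmonoid.mem_sup.mp h
  obtain ⟨n, rfl⟩ := AddSubmonoid.mem_closure_singleton.mp hx
  refine ⟨n, d, y, hd, hy, ?_⟩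
  rw [smul_neg, smul_neg] at e
  rw [← sub_eq_zero] at e ⊢
  rw [← neg_eq_zero, ← e]
  abel

theorem mem_dualCone_nsmul {σ : PointedCone ℝ (RealSpace N)} {d : ℕ} (hd : 0 < d)
    {m : DualLattice N} (h : realForm (d • m) ∈ dualCone σ) : realForm m ∈ dualCone σ := by
  intro v hv
  have h1 : 0 ≤ realForm (d • m) v := h hv
  rw [realForm_nsmul, LinearMap.smul_apply, nsmul_eq_mul] at h1
  exact nonneg_of_mul_nonneg_right h1 (by exact_mod_cast hd)

theorem fg_of_rational [Module.Free ℤ N] [Module.Finite ℤ N] (s : Finset N) :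
    ∃ S : AddSubmonoid (DualLattice N), S.FG ∧ ∀ m, m ∈ S ↔ ∀ n ∈ s, 0 ≤ m n := by
  classical
  let b := Module.Free.chooseBasis ℤ (DualLattice N)
  let ι := Module.Free.ChooseBasisIndex ℤ (DualLattice N)
  let q : ((ι ⊕ ι) ⊕ s → ℕ) →+ DualLattice N :=
    { toFun := fun p ↦ ∑ i, ((p (.inl (.inl i)) : ℤ) - p (.inl (.inr i))) • b i
      map_zero' := by simp
      map_add' := fun p p' ↦ by
        rw [← Finset.sum_add_distrib]
        refine Finset.sum_congr rfl fun i _ ↦ ?_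
        rw [← add_smul]
        congr 1
        simp only [Pi.add_apply, Nat.cast_add]
        ring }
  let f : ((ι ⊕ ι) ⊕ s → ℕ) →+ (s → ℤ) :=
    { toFun := fun p n ↦ q p n.1
      map_zero' := by ext; simp
      map_add' := fun p p' ↦ by ext; simp }
  let g : ((ι ⊕ ι) ⊕ s → ℕ) →+ (s → ℤ) :=
    { toFun := fun p n ↦ p (.inr n)
      map_zero' := by ext; simp
      map_add' := fun p p' ↦ by ext; simp }
  refine ⟨(f.eqLocusM g).map q, (AddSubmonoid.fg_eqLocusM f g).map q, fun m ↦ ⟨?_, fun h ↦ ?_⟩⟩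
  · rintro ⟨p, hp, rfl⟩ n hn
    have : f p ⟨n, hn⟩ = g p ⟨n, hn⟩ := congrFun hp _
    change 0 ≤ f p ⟨n, hn⟩
    rw [this]
    exact Int.natCast_nonneg _
  · let p : (ι ⊕ ι) ⊕ s → ℕ := Sum.elim
      (Sum.elim (fun i ↦ (b.repr m i).toNat) (fun i ↦ (-b.repr m i).toNat)) (fun n ↦ (m n).toNat)
    have hq : q p = m := by
      change ∑ i, (((b.repr m i).toNat : ℤ) - ((-b.repr m i).toNat : ℤ)) • b i = m
      conv_rhs => rw [← b.sum_repr m]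
      refine Finset.sum_congr rfl fun i _ ↦ ?_
      rw [Int.toNat_sub_toNat_neg]
    refine ⟨p, ?_, hq⟩
    ext n
    change q p n.1 = ((m n).toNat : ℤ)
    rw [hq, Int.toNat_of_nonneg (h n.1 n.2)]

/-- The semigroup `σ^∨ ∩ M`. -/
def latticePoints (σ : PointedCone ℝ (RealSpace N)) : AddSubmonoid (DualLattice N) where
  carrier := {m | realForm m ∈ dualCone σ}
  zero_mem' := by
    have : realForm (0 : DualLattice N) ∈ dualCone σ := by
      rw [realForm_zero]
      exact zero_mem _
    exact this
  add_mem' := fun {a b} ha hb ↦ by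
    have : realForm (a + b) ∈ dualCone σ := by
      rw [realForm_add]
      exact add_mem ha hb
    exact this

/-- The triple `(N, Σ, (σ^∨ ∩ M)_σ)`, which defines the normal toric variety `T_Σ`. -/
def saturation [Module.Free ℤ N] [Module.Finite ℤ N] : FanWithSemigroups N where
  toFan := X.toFan
  semigroup σ := latticePoints σ.1
  fg σ := by
    obtain ⟨s, hs⟩ := X.rational σ.1 σ.2
    obtain ⟨S, hS, h⟩ := fg_of_rational s
    suffices hE : latticePoints σ.1 = S by rwa [hE]
    ext m
    rw [h m]
    change realForm m ∈ dualCone σ.1 ↔ _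
    rw [dualCone, hs, PointedCone.dual_hull]
    constructor
    · intro h n hn
      have : 0 ≤ realForm m ((1 : ℝ) ⊗ₜ[ℤ] n) := h ⟨n, hn, rfl⟩
      rw [realForm_one_tmul] at this
      exact_mod_cast this
    · rintro h _ ⟨n, hn, rfl⟩
      change 0 ≤ realForm m ((1 : ℝ) ⊗ₜ[ℤ] n)
      rw [realForm_one_tmul]
      exact_mod_cast h n hn
  generates σ := by
    rw [eq_top_iff, ← X.generates σ]
    exact AddSubgroup.closure_mono fun m hm v hv ↦ X.nonneg_of_mem hm hv
  hull_eq σ := by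
    refine le_antisymm (Submodule.span_le.mpr ?_) ?_
    · rintro _ ⟨m, hm, rfl⟩
      exact hm
    · rw [← X.hull_eq]
      exact Submodule.span_mono (Set.image_mono fun m hm ↦
        show realForm m ∈ dualCone σ.1 from fun v hv ↦ X.nonneg_of_mem hm hv)
  face_eq σ τ h := by
    refine le_antisymm (fun m hm ↦ ?_) (sup_le ?_ ?_)
    · obtain ⟨d, hd, hdm⟩ := X.exists_nsmul_mem τ m fun v hv ↦ hm hv
      obtain ⟨a, ha⟩ := X.exists_isFaceElement σ h.le
      obtain ⟨n, hn⟩ := IsFaceElement.exists_add_mem X (show τ ≤ σ from h.le) ha hdm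
      have h1 : d • (m + n • a) ∈ X.semigroup σ := by
        have : d • (m + n • a) = (d • m + n • a) + ((d - 1) * n) • a := by
          obtain ⟨e, rfl⟩ := Nat.exists_eq_add_of_lt hd
          simp only [zero_add, Nat.add_sub_cancel, smul_add, smul_smul, add_smul, add_mul, one_mul]
          abel
        rw [this]
        exact add_mem hn (nsmul_mem ha.mem _)
      have h2 : realForm (m + n • a) ∈ dualCone σ.1 :=
        mem_dualCone_nsmul hd fun v hv ↦ X.nonneg_of_mem h1 hv
      refine AddSubmonoid.mem_sup.mpr ⟨m + n • a, h2, -(n • a), ?_, by abel⟩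
      have h3 : a ∈ faceLattice τ.1 (latticePoints σ.1) :=
        AddSubgroup.subset_closure ⟨fun v hv ↦ X.nonneg_of_mem ha.mem hv, ha.mem_perp⟩
      have h4 : -(n • a) ∈ faceLattice τ.1 (latticePoints σ.1) := neg_mem (nsmul_mem h3 n)
      exact h4
    · exact fun m hm v hv ↦ hm (h.le hv)
    · intro m hm v hv
      change m ∈ AddSubgroup.closure _ at hm
      have : m ∈ perp τ.1 := by
        induction hm using AddSubgroup.closure_induction with
        | mem x hx => exact hx.2
        | zero => exact zero_mem_perp _
        | add x y _ _ hx hy => exact add_mem_perp hx hy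
        | neg x _ hx => exact neg_mem_perp hx
      exact (this v hv).ge

end FanWithSemigroups
end Combinatorics

/-! ## Affine charts and tori -/

section Affine

variable (k : Type u) [Field k]

/-- The base `Spec k`. -/
abbrev base : Scheme.{u} := Spec (.of k)

/-- The affine scheme `T^A = Spec k[t^A]` over `k` of a commutative monoid `A`. -/
abbrev affineScheme (A : Type u) [AddCommMonoid A] : Over (base k) :=
  (Spec (.of (AddMonoidAlgebra k A))).asOver (base k)

/-- The morphism `T^B ⟶ T^A` over `k` given by `t^a ↦ t^(g a)`. -/
def affineMap {A B : Type u} [AddCommMonoid A] [AddCommMonoid B] (g : A →+ B) :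
    affineScheme k B ⟶ affineScheme k A :=
  (Spec.map (CommRingCat.ofHom
    (AddMonoidAlgebra.mapDomainAlgHom k k g).toRingHom)).asOver (base k)

/-- The torus `T^M = Spec k[t^M]`, `M = Hom(N, ℤ)`; it is a group scheme over `k` through the
Hopf algebra structure of `k[t^M]`. -/
abbrev torus (N : Type u) [AddCommGroup N] : Over (base k) :=
  affineScheme k (DualLattice N)

/-- The morphism of tori `T^{M'} ⟶ T^M` given by `t^m ↦ t^(φ^* m)`, where `φ^*` is the dual of
`φ_* : N' → N`. -/
def torusMap {N N' : Type u} [AddCommGroup N] [AddCommGroup N']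
    (φs : N' →ₗ[ℤ] N) : torus k N' ⟶ torus k N :=
  affineMap k φs.dualMap.toAddMonoidHom

theorem affineMap_id (A : Type u) [AddCommMonoid A] :
    affineMap k (AddMonoidHom.id A) = 𝟙 _ := by
  have h : AddMonoidAlgebra.mapDomainAlgHom k k (AddMonoidHom.id A) = AlgHom.id k _ := by
    ext; simp
  ext1
  change Spec.map (CommRingCat.ofHom (AddMonoidAlgebra.mapDomainAlgHom k k
    (AddMonoidHom.id A)).toRingHom) = 𝟙 _
  rw [h]
  exact Spec.map_id _

theorem affineMap_comp {A B C : Type u} [AddCommMonoid A] [AddCommMonoid B] [AddCommMonoid C]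
    (g : A →+ B) (h : B →+ C) :
    affineMap k h ≫ affineMap k g = affineMap k (h.comp g) := by
  have e : AddMonoidAlgebra.mapDomainAlgHom k k (h.comp g) =
      (AddMonoidAlgebra.mapDomainAlgHom k k h).comp (AddMonoidAlgebra.mapDomainAlgHom k k g) := by
    ext; simp
  ext1
  change Spec.map _ ≫ Spec.map _ = Spec.map (CommRingCat.ofHom
    (AddMonoidAlgebra.mapDomainAlgHom k k (h.comp g)).toRingHom)
  rw [← Spec.map_comp, e]
  rfl

open MonoidalCategory MonObj in
/-- The action of the torus on `T^S` for a semigroup `S ⊆ M`: it is given by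
`t^s ↦ t^s ⊗ t^s ∈ k[t^M] ⊗ k[t^S]`. -/
def affineAction {N : Type u} [AddCommGroup N] (S : AddSubmonoid (DualLattice N)) :
    torus k N ⊗ affineScheme k S ⟶ affineScheme k S :=
  affineMap k S.subtype ▷ affineScheme k S ≫ μ

instance isMonHom_affineMap {A B : Type u} [AddCommMonoid A] [AddCommMonoid B] (g : A →+ B) :
    IsMonHom (affineMap k g) :=
  ((bialgSpec (.of k)).map
    (.op (CommBialgCat.ofHom (AddMonoidAlgebra.mapDomainBialgHom k g)))).isMonHom_hom

/-- If `T = S + ℕ (-a)` then `T^T ⟶ T^S` is the inclusion of the principal open set `t^a ≠ 0`. -/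
theorem isLocalization_away {M : Type u} [AddCommGroup M] {S T : AddSubmonoid M} (hST : S ≤ T)
    (a : M) (ha : a ∈ S) (hna : -a ∈ T) (h : ∀ m ∈ T, ∃ n : ℕ, m + n • a ∈ S) :
    letI := (AddMonoidAlgebra.mapDomainAlgHom k k
      (AddSubmonoid.inclusion hST)).toRingHom.toAlgebra
    IsLocalization.Away (AddMonoidAlgebra.single (⟨a, ha⟩ : S) (1 : k))
      (AddMonoidAlgebra k T) := by
  letI := (AddMonoidAlgebra.mapDomainAlgHom k k
      (AddSubmonoid.inclusion hST)).toRingHom.toAlgebra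
  have hmap : ∀ x, algebraMap (AddMonoidAlgebra k S) (AddMonoidAlgebra k T) x =
      AddMonoidAlgebra.mapDomain (AddSubmonoid.inclusion hST) x := fun x ↦ rfl
  refine IsLocalization.Away.mk _ ?_ (fun z ↦ ?_) (fun x y hxy ↦ ⟨0, ?_⟩)
  · refine IsUnit.of_mul_eq_one (AddMonoidAlgebra.single (⟨-a, hna⟩ : T) (1 : k)) ?_
    rw [hmap, AddMonoidAlgebra.mapDomain_single, AddMonoidAlgebra.single_mul_single,
      AddMonoidAlgebra.one_def, one_mul]
    congr 1
    ext
    simp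
  · induction z using AddMonoidAlgebra.induction_linear with
    | zero => exact ⟨0, 0, by simp⟩
    | add z w hz hw =>
      obtain ⟨n, x, hx⟩ := hz
      obtain ⟨n', y, hy⟩ := hw
      refine ⟨n + n', x * AddMonoidAlgebra.single ⟨a, ha⟩ 1 ^ n' +
        y * AddMonoidAlgebra.single ⟨a, ha⟩ 1 ^ n, ?_⟩
      rw [map_add, map_mul, map_mul, ← hx, ← hy, map_pow, map_pow]
      ring
    | single m r =>
      obtain ⟨n, hn⟩ := h m.1 m.2
      refine ⟨n, AddMonoidAlgebra.single (⟨m.1 + n • a, hn⟩ : S) r, ?_⟩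
      rw [hmap, hmap, AddMonoidAlgebra.mapDomain_single, AddMonoidAlgebra.mapDomain_single,
        AddMonoidAlgebra.single_pow, AddMonoidAlgebra.single_mul_single, one_pow, mul_one]
      congr 1
  · rw [pow_zero, one_mul, one_mul]
    exact AddMonoidAlgebra.mapDomain_injective (AddSubmonoid.inclusion_injective hST) hxy

/-- The inclusion `T^T ⟶ T^S` for semigroups `S ≤ T`, given by the inclusion of algebras. -/
def inclusionMap {M : Type u} [AddCommGroup M] {S T : AddSubmonoid M} (h : S ≤ T) :
    affineScheme k T ⟶ affineScheme k S :=
  affineMap k (AddSubmonoid.inclusion h)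

open MonoidalCategory MonObj in
theorem whiskerLeft_inclusionMap_affineAction {N : Type u} [AddCommGroup N]
    {S T : AddSubmonoid (DualLattice N)} (h : S ≤ T) :
    torus k N ◁ inclusionMap k h ≫ affineAction k S = affineAction k T ≫ inclusionMap k h := by
  have h1 : affineMap k S.subtype = affineMap k T.subtype ≫ inclusionMap k h :=
    (affineMap_comp k (AddSubmonoid.inclusion h) T.subtype).symm
  have h2 := IsMonHom.mul_hom (f := affineMap k (AddSubmonoid.inclusion h))
  change μ ≫ inclusionMap k h = (inclusionMap k h ⊗ₘ inclusionMap k h) ≫ μ at h2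
  rw [affineAction, affineAction, Category.assoc, h2, h1]
  simp only [MonoidalCategory.tensorHom_def, comp_whiskerRight, Category.assoc]
  rw [← whisker_exchange_assoc, ← whisker_exchange_assoc]

theorem inclusionMap_refl {M : Type u} [AddCommGroup M] (S : AddSubmonoid M) :
    inclusionMap k (le_refl S) = 𝟙 _ :=
  affineMap_id k S

theorem inclusionMap_comp {M : Type u} [AddCommGroup M] {S T U : AddSubmonoid M} (h : S ≤ T)
    (h' : T ≤ U) : inclusionMap k h' ≫ inclusionMap k h = inclusionMap k (h.trans h') :=
  affineMap_comp k (AddSubmonoid.inclusion h) (AddSubmonoid.inclusion h')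

theorem isOpenImmersion_inclusionMap {M : Type u} [AddCommGroup M] {S T : AddSubmonoid M}
    (hST : S ≤ T) (a : M) (ha : a ∈ S) (hna : -a ∈ T) (h : ∀ m ∈ T, ∃ n : ℕ, m + n • a ∈ S) :
    IsOpenImmersion (inclusionMap k hST).left := by
  letI := (AddMonoidAlgebra.mapDomainAlgHom k k
    (AddSubmonoid.inclusion hST)).toRingHom.toAlgebra
  have := isLocalization_away k hST a ha hna h
  exact IsOpenImmersion.of_isLocalization
    (AddMonoidAlgebra.single (⟨a, ha⟩ : S) (1 : k))

theorem mem_range_inclusionMap {M : Type u} [AddCommGroup M] {S T : AddSubmonoid M}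
    (hST : S ≤ T) (a : M) (ha : a ∈ S) (hna : -a ∈ T) (h : ∀ m ∈ T, ∃ n : ℕ, m + n • a ∈ S)
    (x : PrimeSpectrum (AddMonoidAlgebra k S)) :
    x ∈ Set.range (inclusionMap k hST).left ↔
      AddMonoidAlgebra.single (⟨a, ha⟩ : S) (1 : k) ∉ x.asIdeal := by
  letI := (AddMonoidAlgebra.mapDomainAlgHom k k
    (AddSubmonoid.inclusion hST)).toRingHom.toAlgebra
  have := isLocalization_away k hST a ha hna h
  have h1 := PrimeSpectrum.localization_away_comap_range (AddMonoidAlgebra k T)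
    (AddMonoidAlgebra.single (⟨a, ha⟩ : S) (1 : k))
  have h2 := Set.ext_iff.mp h1 x
  exact h2

end Affine

section Variety

variable {N : Type u} [AddCommGroup N] (X : FanWithSemigroups N) (k : Type u) [Field k]

namespace FanWithSemigroups

/-- The diagram of the charts `T^{Γ_σ}`, indexed by the fan ordered by the face relation. -/
def charts : X.cones ⥤ Over (base k) where
  obj σ := affineScheme k (X.semigroup σ)
  map h := inclusionMap k (X.semigroup_mono (leOfHom h))
  map_id σ := inclusionMap_refl k _
  map_comp f g := (inclusionMap_comp k _ _).symm

/-- The underlying diagram of schemes. -/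
abbrev chartSchemes : X.cones ⥤ Scheme.{u} := X.charts k ⋙ Over.forget _

instance isOpenImmersion_map {σ τ : X.cones} (f : τ ⟶ σ) : IsOpenImmersion ((X.chartSchemes k).map f) := by
  obtain ⟨a, ha⟩ := X.exists_isFaceElement σ (τ := τ.1) (leOfHom f)
  exact isOpenImmersion_inclusionMap k _ a ha.mem (IsFaceElement.neg_mem X (leOfHom f) ha)
    fun m hm ↦ IsFaceElement.exists_add_mem X (leOfHom f) ha hm

theorem inf_mem (σ τ : X.cones) : σ.1 ⊓ τ.1 ∈ X.cones :=
  X.face_mem σ.1 σ.2 _ (X.inter_face σ.1 σ.2 τ.1 τ.2)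

instance : (X.chartSchemes k ⋙ Scheme.forget).IsLocallyDirected where
  cond {i j l} fi fj xi xj hx := by
    let m : X.cones := ⟨i.1 ⊓ j.1, X.inf_mem i j⟩
    have hmi : m ≤ i := show i.1 ⊓ j.1 ≤ i.1 from inf_le_left
    have hmj : m ≤ j := show i.1 ⊓ j.1 ≤ j.1 from inf_le_right
    have hi : i ≤ l := leOfHom fi
    have hj : j ≤ l := leOfHom fj
    have hm : m ≤ l := hmi.trans hi
    obtain ⟨a, ha⟩ := X.exists_isFaceElement l (τ := i.1) hi
    obtain ⟨b, hb⟩ := X.exists_isFaceElement l (τ := j.1) hj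
    obtain ⟨c, hc⟩ := X.exists_isFaceElement l (τ := m.1) hm
    let x : PrimeSpectrum (AddMonoidAlgebra k (X.semigroup l)) := (X.chartSchemes k).map fi xi
    have hxa := (mem_range_inclusionMap k (X.semigroup_mono hi) a ha.mem
      (IsFaceElement.neg_mem X hi ha) (fun _ h ↦ IsFaceElement.exists_add_mem X hi ha h) x).mp
      ⟨xi, rfl⟩
    have hxb := (mem_range_inclusionMap k (X.semigroup_mono hj) b hb.mem
      (IsFaceElement.neg_mem X hj hb) (fun _ h ↦ IsFaceElement.exists_add_mem X hj hb h) x).mp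
      ⟨xj, hx.symm⟩
    have hxc : AddMonoidAlgebra.single (⟨c, hc.mem⟩ : X.semigroup l) (1 : k) ∉ x.asIdeal := by
      intro hcx
      obtain ⟨n, d, γ, hd, hγ, e⟩ := X.exists_nsmul_add_eq hi hj ha hb hc.mem_perp
      have hp := x.isPrime
      have e' : (AddMonoidAlgebra.single (⟨a, ha.mem⟩ : X.semigroup l) (1 : k) *
          AddMonoidAlgebra.single (⟨b, hb.mem⟩ : X.semigroup l) (1 : k)) ^ n =
          AddMonoidAlgebra.single (⟨c, hc.mem⟩ : X.semigroup l) (1 : k) ^ d *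
          AddMonoidAlgebra.single (⟨γ, hγ⟩ : X.semigroup l) (1 : k) := by
        rw [AddMonoidAlgebra.single_mul_single, AddMonoidAlgebra.single_pow,
          AddMonoidAlgebra.single_pow, AddMonoidAlgebra.single_mul_single]
        congr 1
        · exact Subtype.ext e
        · simp
      have h1 : (AddMonoidAlgebra.single (⟨a, ha.mem⟩ : X.semigroup l) (1 : k) *
          AddMonoidAlgebra.single (⟨b, hb.mem⟩ : X.semigroup l) (1 : k)) ^ n ∈ x.asIdeal := by
        rw [e']
        exact Ideal.mul_mem_right _ _ (Ideal.pow_mem_of_mem _ hcx _ hd)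
      rcases hp.mem_or_mem (hp.mem_of_pow_mem _ h1) with h | h
      · exact hxa h
      · exact hxb h
    obtain ⟨y, hy⟩ := (mem_range_inclusionMap k (X.semigroup_mono hm) c hc.mem
      (IsFaceElement.neg_mem X hm hc) (fun _ h ↦ IsFaceElement.exists_add_mem X hm hc h) x).mpr hxc
    have key : ∀ (i' : X.cones) (f : i' ⟶ l) (g : m ⟶ i'),
        (X.chartSchemes k).map f ((X.chartSchemes k).map g y) = x := by
      intro i' f g
      have hy' : (X.chartSchemes k).map (g ≫ f) y = x := hy
      rw [Functor.map_comp] at hy'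
      exact hy'
    refine ⟨m, homOfLE hmi, homOfLE hmj, y, ?_, ?_⟩
    · exact ((X.chartSchemes k).map fi).isOpenEmbedding.injective (key i fi (homOfLE hmi))
    · exact ((X.chartSchemes k).map fj).isOpenEmbedding.injective ((key j fj (homOfLE hmj)).trans hx)

/-- The toric variety `T_Σ^Γ`: the charts `T^{Γ_σ}`, glued along the charts of common faces. -/
def variety : Over (base k) :=
  Over.mk (Limits.colimit.desc (X.chartSchemes k)
    ⟨base k, { app := fun σ ↦ ((X.charts k).obj σ).hom, naturality := fun σ τ f ↦ by simp }⟩)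

/-- The inclusion of the chart `T^{Γ_σ}`. -/
def ι (σ : X.cones) : affineScheme k (X.semigroup σ) ⟶ X.variety k :=
  Over.homMk (Limits.colimit.ι (X.chartSchemes k) σ) (Limits.colimit.ι_desc _ _)

theorem inclusionMap_ι {σ τ : X.cones} (h : τ ≤ σ) :
    inclusionMap k (X.semigroup_mono h) ≫ X.ι k σ = X.ι k τ := by
  ext1
  exact Limits.colimit.w (X.chartSchemes k) (homOfLE h)

/-- Glueing of morphisms from the charts. -/
def desc {Y : Over (base k)} (g : ∀ σ, affineScheme k (X.semigroup σ) ⟶ Y)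
    (hg : ∀ {σ τ : X.cones} (h : τ ≤ σ), inclusionMap k (X.semigroup_mono h) ≫ g σ = g τ) :
    X.variety k ⟶ Y :=
  Over.homMk
    (Limits.colimit.desc (X.chartSchemes k)
      ⟨Y.left, { app := fun σ ↦ (g σ).left
                 naturality := fun τ σ f ↦
                  (congrArg Over.Hom.left (hg (leOfHom f))).trans (Category.comp_id _).symm }⟩)
    (by
      refine Limits.colimit.hom_ext fun σ ↦ ?_
      refine (Limits.colimit.ι_desc_assoc _ _ _).trans ?_
      exact (Over.w (g σ)).trans (Over.w (X.ι k σ)).symm)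

theorem ι_desc {Y : Over (base k)} (g : ∀ σ, affineScheme k (X.semigroup σ) ⟶ Y)
    (hg : ∀ {σ τ : X.cones} (h : τ ≤ σ), inclusionMap k (X.semigroup_mono h) ≫ g σ = g τ)
    (σ : X.cones) : X.ι k σ ≫ X.desc k g hg = g σ := by
  apply Over.OverMorphism.ext
  exact Limits.colimit.ι_desc _ _

/-- The cover of `T_Σ^Γ` by the charts. -/
def cover : (X.variety k).left.OpenCover :=
  Scheme.IsLocallyDirected.openCover (X.chartSchemes k)

instance : Category (X.cover k).I₀ := inferInstanceAs (Category X.cones)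

instance : (X.cover k).LocallyDirected where
  trans {i j} hij := (X.chartSchemes k).map hij
  trans_id i := (X.chartSchemes k).map_id i
  trans_comp f g := (X.chartSchemes k).map_comp f g
  w f := Limits.colimit.w (X.chartSchemes k) f
  directed {i j} x := by
    obtain ⟨l, fi, fj, y, h1, h2⟩ := (Scheme.IsLocallyDirected.ι_eq_ι_iff (X.chartSchemes k)
      (xi := Limits.pullback.fst ((X.cover k).f i) ((X.cover k).f j) x)
      (xj := Limits.pullback.snd ((X.cover k).f i) ((X.cover k).f j) x)).mp (by
        change (X.cover k).f i _ = (X.cover k).f j _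
        rw [← Scheme.Hom.comp_apply, ← Scheme.Hom.comp_apply, Limits.pullback.condition])
    refine ⟨l, fi, fj, y, ?_⟩
    apply (Limits.pullback.fst ((X.cover k).f i) ((X.cover k).f j)).isOpenEmbedding.injective
    refine Eq.trans ?_ h1
    have h3 := Limits.pullback.lift_fst (f := (X.cover k).f i) (g := (X.cover k).f j)
      ((X.chartSchemes k).map fi) ((X.chartSchemes k).map fj)
      ((Limits.colimit.w (X.chartSchemes k) fi).trans
        (Limits.colimit.w (X.chartSchemes k) fj).symm)
    exact congrArg (fun g : (X.chartSchemes k).obj l ⟶ (X.chartSchemes k).obj i ↦ g y) h3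
  property_trans {i j} f := X.isOpenImmersion_map k (σ := j) (τ := i) f

open MonoidalCategory CartesianMonoidalCategory MonObj

/-- The cover of `T^M × T_Σ^Γ` by the `T^M × T^{Γ_σ}`. -/
def prodCover : (torus k N ⊗ X.variety k).left.OpenCover :=
  (X.cover k).pullback₁ (snd (torus k N) (X.variety k)).left

instance : Category (X.prodCover k).I₀ := inferInstanceAs (Category X.cones)

instance : (X.prodCover k).LocallyDirected :=
  Scheme.Cover.locallyDirectedPullbackCover (X.cover k) (snd (torus k N) (X.variety k)).left

/-- The members of `prodCover`. -/
def prodPiece (σ : X.cones) : Over (base k) :=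
  Over.mk ((X.prodCover k).f σ ≫ (torus k N ⊗ X.variety k).hom)

/-- The inclusions of the members of `prodCover`. -/
def prodPieceι (σ : X.cones) : X.prodPiece k σ ⟶ torus k N ⊗ X.variety k :=
  Over.homMk ((X.prodCover k).f σ) rfl

theorem prodPiece_condition (σ : X.cones) :
    (X.prodPieceι k σ).left ≫ (snd (torus k N) (X.variety k)).left =
      Limits.pullback.snd (snd (torus k N) (X.variety k)).left ((X.cover k).f σ) ≫
        (X.ι k σ).left :=
  Limits.pullback.condition

/-- The projection of a member of `prodCover` to the chart. -/
def prodPieceSnd (σ : X.cones) : X.prodPiece k σ ⟶ affineScheme k (X.semigroup σ) :=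
  Over.homMk (Limits.pullback.snd (snd (torus k N) (X.variety k)).left ((X.cover k).f σ)) (by
    have h1 := X.prodPiece_condition k σ
    have h2 := Over.w (snd (torus k N) (X.variety k))
    have h3 := Over.w (X.ι k σ)
    have h4 := Over.w (X.prodPieceι k σ)
    refine (congrArg (Limits.pullback.snd _ _ ≫ ·) h3.symm).trans ?_
    refine (Category.assoc _ _ _).symm.trans ?_
    refine (congrArg (· ≫ (X.variety k).hom) h1.symm).trans ?_
    refine (Category.assoc _ _ _).trans ?_
    exact (congrArg ((X.prodPieceι k σ).left ≫ ·) h2).trans h4)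

theorem prodPieceSnd_ι (σ : X.cones) :
    X.prodPieceSnd k σ ≫ X.ι k σ = X.prodPieceι k σ ≫ snd _ _ := by
  ext1
  exact (X.prodPiece_condition k σ).symm

/-- The members of `prodCover` are the `T^M × T^{Γ_σ}`. -/
def toTorusProdChart (σ : X.cones) :
    X.prodPiece k σ ⟶ torus k N ⊗ affineScheme k (X.semigroup σ) :=
  lift (X.prodPieceι k σ ≫ fst _ _) (X.prodPieceSnd k σ)

theorem toTorusProdChart_whiskerLeft_ι (σ : X.cones) :
    X.toTorusProdChart k σ ≫ torus k N ◁ X.ι k σ = X.prodPieceι k σ := by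
  refine CartesianMonoidalCategory.hom_ext _ _ ?_ ?_
  · rw [Category.assoc, whiskerLeft_fst, toTorusProdChart, lift_fst]
  · rw [Category.assoc, whiskerLeft_snd, toTorusProdChart, lift_snd_assoc, prodPieceSnd_ι]

/-- The transition maps of `prodCover`. -/
def prodTrans {σ τ : X.cones} (f : σ ⟶ τ) : X.prodPiece k σ ⟶ X.prodPiece k τ :=
  Over.homMk (Scheme.Cover.trans (X.prodCover k) (i := σ) (j := τ) f)
    (((Category.assoc _ _ _).symm).trans
      (congrArg (· ≫ _) (Scheme.Cover.trans_map (X.prodCover k) (i := σ) (j := τ) f)))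

theorem prodTrans_prodPieceι {σ τ : X.cones} (f : σ ⟶ τ) :
    X.prodTrans k f ≫ X.prodPieceι k τ = X.prodPieceι k σ := by
  apply Over.OverMorphism.ext
  exact Scheme.Cover.trans_map (X.prodCover k) (i := σ) (j := τ) f

instance isOpenImmersion_ι (σ : X.cones) : IsOpenImmersion (X.ι k σ).left :=
  inferInstanceAs (IsOpenImmersion (Limits.colimit.ι (X.chartSchemes k) σ))

instance mono_ι (σ : X.cones) : Mono (X.ι k σ) :=
  Over.mono_of_mono_left _

instance mono_whiskerLeft_ι (σ : X.cones) : Mono (torus k N ◁ X.ι k σ) where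
  right_cancellation f g h := by
    refine CartesianMonoidalCategory.hom_ext _ _ ?_ ?_
    · have := congrArg (· ≫ fst _ _) h
      simpa using this
    · have := congrArg (· ≫ snd _ _) h
      simp only [Category.assoc, whiskerLeft_snd] at this
      rwa [← Category.assoc, ← Category.assoc, cancel_mono] at this

theorem prodTrans_toTorusProdChart {σ τ : X.cones} (f : σ ⟶ τ) :
    X.prodTrans k f ≫ X.toTorusProdChart k τ =
      X.toTorusProdChart k σ ≫ torus k N ◁ inclusionMap k (X.semigroup_mono (leOfHom f)) := by
  rw [← cancel_mono (torus k N ◁ X.ι k τ), Category.assoc, Category.assoc,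
    toTorusProdChart_whiskerLeft_ι, ← MonoidalCategory.whiskerLeft_comp, X.inclusionMap_ι k (leOfHom f),
    toTorusProdChart_whiskerLeft_ι, prodTrans_prodPieceι]

theorem prodTrans_comp {σ τ : X.cones} (f : σ ⟶ τ) :
    X.prodTrans k f ≫ X.toTorusProdChart k τ ≫ affineAction k (X.semigroup τ) ≫ X.ι k τ =
      X.toTorusProdChart k σ ≫ affineAction k (X.semigroup σ) ≫ X.ι k σ := by
  rw [← Category.assoc, prodTrans_toTorusProdChart, Category.assoc,
    ← Category.assoc (torus k N ◁ _), whiskerLeft_inclusionMap_affineAction,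
    Category.assoc, X.inclusionMap_ι k (leOfHom f)]

/-- The action of the torus `T^M` on `T_Σ^Γ`: on the charts it is `affineAction`. -/
def action : torus k N ⊗ X.variety k ⟶ X.variety k :=
  Scheme.OpenCover.glueMorphismsOverOfLocallyDirected (X.prodCover k)
    (fun σ ↦ (X.toTorusProdChart k σ ≫ affineAction k (X.semigroup σ) ≫ X.ι k σ).left)
    (fun {σ τ} f ↦ congrArg Over.Hom.left (X.prodTrans_comp k (σ := σ) (τ := τ) f))
    (fun σ ↦ Over.w (X.toTorusProdChart k σ ≫ affineAction k (X.semigroup σ) ≫ X.ι k σ))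

theorem prodPieceι_action (σ : X.cones) :
    X.prodPieceι k σ ≫ X.action k =
      X.toTorusProdChart k σ ≫ affineAction k (X.semigroup σ) ≫ X.ι k σ := by
  apply Over.OverMorphism.ext
  exact Scheme.OpenCover.map_glueMorphismsOverOfLocallyDirected_left (X.prodCover k)
    (fun σ ↦ (X.toTorusProdChart k σ ≫ affineAction k (X.semigroup σ) ≫ X.ι k σ).left)
    (fun {σ τ} f ↦ congrArg Over.Hom.left (X.prodTrans_comp k (σ := σ) (τ := τ) f))
    (fun σ ↦ Over.w (X.toTorusProdChart k σ ≫ affineAction k (X.semigroup σ) ≫ X.ι k σ)) σ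

/-- The inverse of `toTorusProdChart`. -/
def ofTorusProdChart (σ : X.cones) :
    torus k N ⊗ affineScheme k (X.semigroup σ) ⟶ X.prodPiece k σ :=
  Over.homMk (Limits.pullback.lift (torus k N ◁ X.ι k σ).left
      (snd (torus k N) (affineScheme k (X.semigroup σ))).left
      (congrArg Over.Hom.left (whiskerLeft_snd (torus k N) (X.ι k σ))))
    (by
      have h := Over.w (torus k N ◁ X.ι k σ)
      refine (Category.assoc _ _ _).symm.trans (Eq.trans ?_ h)
      exact congrArg (· ≫ (torus k N ⊗ X.variety k).hom)
        (Limits.pullback.lift_fst (torus k N ◁ X.ι k σ).left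
          (snd (torus k N) (affineScheme k (X.semigroup σ))).left
          (congrArg Over.Hom.left (whiskerLeft_snd (torus k N) (X.ι k σ)))))

theorem ofTorusProdChart_prodPieceι (σ : X.cones) :
    X.ofTorusProdChart k σ ≫ X.prodPieceι k σ = torus k N ◁ X.ι k σ := by
  apply Over.OverMorphism.ext
  exact Limits.pullback.lift_fst (torus k N ◁ X.ι k σ).left
      (snd (torus k N) (affineScheme k (X.semigroup σ))).left
      (congrArg Over.Hom.left (whiskerLeft_snd (torus k N) (X.ι k σ)))

/-- The action on the charts. -/
theorem whiskerLeft_ι_action (σ : X.cones) :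
    torus k N ◁ X.ι k σ ≫ X.action k = affineAction k (X.semigroup σ) ≫ X.ι k σ := by
  have h : X.ofTorusProdChart k σ ≫ X.toTorusProdChart k σ = 𝟙 _ := by
    rw [← cancel_mono (torus k N ◁ X.ι k σ), Category.assoc, toTorusProdChart_whiskerLeft_ι,
      ofTorusProdChart_prodPieceι, Category.id_comp]
  rw [← ofTorusProdChart_prodPieceι, Category.assoc, prodPieceι_action, ← Category.assoc, h,
    Category.id_comp]

/-- The zero cone is a face of each cone of the fan. -/
theorem bot_mem : (⊥ : PointedCone ℝ (RealSpace N)) ∈ X.cones := by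
  obtain ⟨σ, hσ⟩ := X.nonempty
  refine X.face_mem σ hσ ⊥ ⟨bot_le, fun {x y a} hx hy ha h ↦ ?_⟩
  rw [Submodule.mem_bot] at h ⊢
  by_contra hx0
  refine X.strictlyConvex σ hσ x hx hx0 ?_
  have hxy : -x = a⁻¹ • y := by
    rw [eq_neg_of_add_eq_zero_right h, smul_neg, smul_smul, inv_mul_cancel₀ ha.ne', one_smul]
  rw [hxy]
  exact PointedCone.smul_mem σ (inv_nonneg.mpr ha.le) hy

/-- The inclusion of the torus `T^M = T^{Γ_0}` in `T_Σ^Γ`. -/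
def torusEmb : torus k N ⟶ X.variety k :=
  affineMap k (X.semigroup ⟨⊥, X.bot_mem⟩).subtype ≫ X.ι k ⟨⊥, X.bot_mem⟩

/-- The inclusion of the torus factors through each chart, where it is given by
`k[t^{Γ_σ}] ⊆ k[t^M]`. -/
theorem affineMap_subtype_ι (σ : X.cones) :
    affineMap k (X.semigroup σ).subtype ≫ X.ι k σ = X.torusEmb k := by
  have h : (⟨⊥, X.bot_mem⟩ : X.cones) ≤ σ := show (⊥ : PointedCone ℝ (RealSpace N)) ≤ σ.1 from bot_le
  rw [torusEmb, ← X.inclusionMap_ι k h, ← Category.assoc, inclusionMap, affineMap_comp]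
  rfl

theorem semigroup_le_saturation [Module.Free ℤ N] [Module.Finite ℤ N] (σ : X.cones) :
    X.semigroup σ ≤ X.saturation.semigroup σ :=
  fun _ hm _ hv ↦ X.nonneg_of_mem hm hv

theorem inclusionMap_normalization [Module.Free ℤ N] [Module.Finite ℤ N] {σ τ : X.cones}
    (h : τ ≤ σ) :
    inclusionMap k (X.saturation.semigroup_mono (σ := σ) (τ := τ) h) ≫
      inclusionMap k (X.semigroup_le_saturation σ) ≫ X.ι k σ =
      inclusionMap k (X.semigroup_le_saturation τ) ≫ X.ι k τ := by
  rw [← Category.assoc, inclusionMap_comp, ← X.inclusionMap_ι k h, ← Category.assoc,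
    inclusionMap_comp]

/-- The morphism `T_Σ ⟶ T_Σ^Γ` glued from the morphisms `T^{σ^∨ ∩ M} ⟶ T^{Γ_σ}` given by the
inclusions `Γ_σ ⊆ σ^∨ ∩ M`. -/
def normalizationMap [Module.Free ℤ N] [Module.Finite ℤ N] :
    X.saturation.variety k ⟶ X.variety k :=
  X.saturation.desc k (fun σ ↦ inclusionMap k (X.semigroup_le_saturation σ) ≫ X.ι k σ)
    fun {_ _} h ↦ X.inclusionMap_normalization k h

theorem ι_normalizationMap [Module.Free ℤ N] [Module.Finite ℤ N] (σ : X.cones) :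
    X.saturation.ι k σ ≫ X.normalizationMap k =
      inclusionMap k (X.semigroup_le_saturation σ) ≫ X.ι k σ :=
  X.saturation.ι_desc k (fun σ ↦ inclusionMap k (X.semigroup_le_saturation σ) ≫ X.ι k σ)
    (fun {_ _} h ↦ X.inclusionMap_normalization k h) σ

end FanWithSemigroups

end Variety

/-! ## Toric morphisms -/

section Morphisms

variable {N N' : Type u} [AddCommGroup N] [AddCommGroup N']

/-- `φ_* : N' → N` is a map of fans with attached semigroups `(N', Σ', Γ') → (N, Σ, Γ)`: for each
`σ' ∈ Σ'` there is `σ ∈ Σ` with `φ^*(Γ_σ) ⊆ Γ'_{σ'}`. -/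
def IsMapOfFans (φs : N' →ₗ[ℤ] N) (X' : FanWithSemigroups N') (X : FanWithSemigroups N) : Prop :=
  ∀ σ' : X'.cones, ∃ σ : X.cones,
    ∀ m ∈ X.semigroup σ, φs.dualMap m ∈ X'.semigroup σ'

/-- The homomorphism `Γ_σ → Γ'_{σ'}` obtained by restricting `φ^*`. -/
def restrictDual (φs : N' →ₗ[ℤ] N) {S : AddSubmonoid (DualLattice N)}
    {S' : AddSubmonoid (DualLattice N')} (h : ∀ m ∈ S, φs.dualMap m ∈ S') : S →+ S' :=
  (φs.dualMap.toAddMonoidHom.comp S.subtype).codRestrict S' fun m ↦ h m.1 m.2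

variable (k : Type u) [Field k]

/-- `f : T_{Σ'}^{Γ'} ⟶ T_Σ^Γ` is the morphism glued from the morphisms
`T^{Γ'_{σ'}} ⟶ T^{Γ_σ}`, `t^m ↦ t^(φ^* m)`, for all `σ'`, `σ` with `φ^*(Γ_σ) ⊆ Γ'_{σ'}`. -/
def IsInduced (φs : N' →ₗ[ℤ] N) {X' : FanWithSemigroups N'} {X : FanWithSemigroups N}
    (f : X'.variety k ⟶ X.variety k) : Prop :=
  ∀ (σ' : X'.cones) (σ : X.cones) (h : ∀ m ∈ X.semigroup σ, φs.dualMap m ∈ X'.semigroup σ'),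
    X'.ι k σ' ≫ f = affineMap k (restrictDual φs h) ≫ X.ι k σ

variable {k}

/-- `f` restricts to `φ` on the tori. -/
def Extends (φ : torus k N' ⟶ torus k N) {X' : FanWithSemigroups N'} {X : FanWithSemigroups N}
    (f : X'.variety k ⟶ X.variety k) : Prop :=
  X'.torusEmb k ≫ f = φ ≫ X.torusEmb k

open MonoidalCategory in
/-- `f` is equivariant with respect to `φ`. -/
def IsEquivariant (φ : torus k N' ⟶ torus k N) {X' : FanWithSemigroups N'}
    {X : FanWithSemigroups N} (f : X'.variety k ⟶ X.variety k) : Prop :=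
  (φ ⊗ₘ f) ≫ X.action k = X'.action k ≫ f

/-- `n : Y ⟶ Z` is a normalization: `Y` is integral and normal, and `n` is integral and
birational. -/
structure IsNormalization {Y Z : Scheme.{u}} (n : Y ⟶ Z) : Prop where
  isIntegral : IsIntegral Y
  isIntegrallyClosed : ∀ y : Y, IsIntegrallyClosed (Y.presheaf.stalk y)
  isIntegralHom : IsIntegralHom n
  birational : ∃ U : Z.Opens, Dense (U : Set Z) ∧ Dense (n ⁻¹ᵁ U : Set Y) ∧ IsIso (n ∣_ U)

end Morphisms

end

end ToricSemigroup

open CategoryTheory ToricSemigroup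

namespace ToricSemigroup

/-! ### Maps of fans and semigroups -/

section Fans

variable {N N' : Type u} [AddCommGroup N] [AddCommGroup N']

/-! Write `U_σ` for the chart `T^{Γ_σ}`. On charts a toric morphism is a homomorphism of semigroups,
so each assertion reduces to semigroups and to the way in which charts meet.

Existence of the induced morphism. If `φ^*` carries both `Γ_σ` and `Γ_τ` into `Γ'_{σ'}`, then `φ_*`
carries `σ'` into `σ ∩ τ`, because a cone is the dual of its semigroup. Elements of `Γ_σ ∩ (σ ∩
τ)^⊥` therefore go to elements of `Γ'_{σ'} ∩ σ'^⊥`, which are invertible in `Γ'_{σ'}`. Hence `φ^*`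
carries `Γ_{σ ∩ τ}` into `Γ'_{σ'}` (`dualMap_mem_inter`), both chart morphisms factor through `U_{σ
∩ τ}`, and they agree. So the chart morphisms glue, whatever `σ` is chosen for each `σ'`.
Equivariance holds because the chart morphisms are homomorphisms of monoid schemes.

Converse. Each chart `U_{σ'}` has a point, `unitPoint`, in the closure of every torus orbit. Its
image under `f` lies in some open chart `U_σ`, which is stable under the torus. For any point `y` of
`U_{σ'}` a generic translate of `y` specializes to `unitPoint`, so its image is in `U_σ`; by
equivariance the image of `y` is too (`range_ι_subset_of_isEquivariant`). Thus `f` maps `U_{σ'}` to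
`U_σ`. As `k[t^{Γ'_{σ'}}]` embeds in `k[t^{M'}]`, the restriction to the torus forces `t^m ↦ t^(φ^*
m)`, and in particular `φ^* m ∈ Γ'_{σ'}`.

Normalization. Every element of `σ^∨ ∩ M` has a positive multiple in `Γ_σ`, so `k[t^{σ^∨ ∩ M}]` is
integral over `k[t^{Γ_σ}]`. It is integrally closed: `k[t^M]` is a localized polynomial ring, and
each half-space containing the semigroup gives a valuation bounding the exponents of integral
elements. The morphism `n` is the identity on the torus, and the preimage of a chart is the chart of
the same cone (`preimage_normalizationMap`), so these local facts suffice. Taking multiples also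
shows that a map of fans with attached semigroups is one for the saturated triples. The first two
assertions, applied to these, give `ψ` and its uniqueness, and the square commutes chart by chart.
-/

theorem realForm_dualMap (φs : N' →ₗ[ℤ] N) (m : DualLattice N) (v : RealSpace N') :
    realForm (φs.dualMap m) v = realForm m (φs.baseChange ℝ v) := by
  induction v using TensorProduct.induction_on with
  | zero => simp
  | tmul r n => simp
  | add v w hv hw => rw [map_add, map_add, map_add, hv, hw]

namespace FanWithSemigroups

variable (X : FanWithSemigroups N) (X' : FanWithSemigroups N')

/-- The face axiom applied to `σ` as a face of itself makes `Γ_σ ∩ σ^⊥` consist of units of `Γ_σ`.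
-/
theorem neg_mem_of_mem_perp (σ : X.cones) {m : DualLattice N} (hm : m ∈ X.semigroup σ)
    (h : m ∈ perp σ.1) : -m ∈ X.semigroup σ := by
  rw [X.face_eq σ σ (X.isFaceOf_of_le le_rfl)]
  refine (le_sup_right : _ ≤ X.semigroup σ ⊔ _) ?_
  exact (AddSubgroup.closure _).neg_mem (AddSubgroup.subset_closure ⟨hm, h⟩)

/-- The cone `{0}` of the fan. -/
abbrev zeroCone : X.cones := ⟨⊥, X.bot_mem⟩

theorem zeroCone_le (σ : X.cones) : X.zeroCone ≤ σ :=
  show (⊥ : PointedCone ℝ (RealSpace N)) ≤ σ.1 from bot_le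

/-- Every form vanishes on the zero cone, so the face axiom for this cone adjoins the whole group
generated by its semigroup. -/
theorem semigroup_zeroCone : X.semigroup X.zeroCone = ⊤ := by
  rw [eq_top_iff, X.face_eq _ _ (X.isFaceOf_of_le (le_refl X.zeroCone))]
  refine le_trans ?_ le_sup_right
  have h : ((X.semigroup X.zeroCone : Set (DualLattice N)) ∩ perp X.zeroCone.1) =
      X.semigroup X.zeroCone := by
    refine Set.inter_eq_left.mpr fun m _ v hv ↦ ?_
    rw [(Submodule.mem_bot _).mp hv, map_zero]
  rw [faceLattice, h, X.generates]
  exact le_rfl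

/-- The intersection of two cones of the fan. -/
abbrev inter (σ τ : X.cones) : X.cones := ⟨σ.1 ⊓ τ.1, X.inf_mem σ τ⟩

theorem inter_le_left (σ τ : X.cones) : X.inter σ τ ≤ σ :=
  show σ.1 ⊓ τ.1 ≤ σ.1 from inf_le_left

theorem inter_le_right (σ τ : X.cones) : X.inter σ τ ≤ τ :=
  show σ.1 ⊓ τ.1 ≤ τ.1 from inf_le_right

variable {X X'} in
-- Duality: `φ_* v` pairs with `m ∈ Γ_σ` as `v` pairs with `φ^* m`, and `σ` is the dual of `Γ_σ`.
theorem baseChange_mem {φs : N' →ₗ[ℤ] N} {σ' : X'.cones} {σ : X.cones}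
    (h : ∀ m ∈ X.semigroup σ, φs.dualMap m ∈ X'.semigroup σ') {v : RealSpace N'}
    (hv : v ∈ σ'.1) : φs.baseChange ℝ v ∈ σ.1 :=
  X.mem_cone_of_nonneg σ _ fun m hm ↦ by
    rw [← realForm_dualMap]
    exact X'.nonneg_of_mem (h m hm) hv

variable {X X'} in
-- The semigroup of `σ ∩ τ` arises from `Γ_σ` by inverting elements orthogonal to `σ ∩ τ`. Since
-- `φ_*` maps `σ'` into `σ ∩ τ`, their images are orthogonal to `σ'`, hence already invertible in
-- `Γ'_{σ'}`.
theorem dualMap_mem_inter {φs : N' →ₗ[ℤ] N} {σ' : X'.cones} {σ τ : X.cones}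
    (hσ : ∀ m ∈ X.semigroup σ, φs.dualMap m ∈ X'.semigroup σ')
    (hτ : ∀ m ∈ X.semigroup τ, φs.dualMap m ∈ X'.semigroup σ') :
    ∀ m ∈ X.semigroup (X.inter σ τ), φs.dualMap m ∈ X'.semigroup σ' := by
  intro m hm
  rw [X.face_eq σ _ (X.isFaceOf_of_le (X.inter_le_left σ τ))] at hm
  obtain ⟨x, hx, y, hy, rfl⟩ := AddSubmonoid.mem_sup.mp hm
  rw [map_add]
  refine add_mem (hσ x hx) ?_
  -- Both signs are proved together so that the induction over the generated group passes through
  -- negation.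
  have key : φs.dualMap y ∈ X'.semigroup σ' ∧ -φs.dualMap y ∈ X'.semigroup σ' := by
    clear hm
    change y ∈ AddSubgroup.closure _ at hy
    induction hy using AddSubgroup.closure_induction with
    | mem y hy =>
      refine ⟨hσ y hy.1, X'.neg_mem_of_mem_perp σ' (hσ y hy.1) fun v hv ↦ ?_⟩
      rw [realForm_dualMap]
      exact hy.2 _ ⟨baseChange_mem hσ hv, baseChange_mem hτ hv⟩
    | zero => simp
    | add a b _ _ ha hb =>
      rw [map_add, neg_add]
      exact ⟨add_mem ha.1 hb.1, add_mem ha.2 hb.2⟩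
    | neg a _ ha =>
      rw [map_neg, neg_neg]
      exact ⟨ha.2, ha.1⟩
  exact key.1

section Saturation

variable [Module.Free ℤ N] [Module.Finite ℤ N]

theorem exists_nsmul_mem_of_mem_saturation {σ : X.cones} {m : DualLattice N}
    (hm : m ∈ X.saturation.semigroup σ) : ∃ d : ℕ, 0 < d ∧ d • m ∈ X.semigroup σ :=
  X.exists_nsmul_mem σ m fun _ hv ↦ hm hv

theorem mem_saturation_of_nsmul_mem {σ : X.cones} {m : DualLattice N} {d : ℕ} (hd : 0 < d)
    (hm : d • m ∈ X.semigroup σ) : m ∈ X.saturation.semigroup σ :=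
  mem_dualCone_nsmul hd fun _ hv ↦ X.nonneg_of_mem hm hv

variable {X} in
-- If `d • γ + γ' = n • a` with `d > 0`, then `(d - 1) • γ + γ'` complements `γ` itself to `n • a`.
-- So one monomial `t^a` cuts out the chart of a face both in `T_Σ^Γ` and in `T_Σ`, which is what
-- locates preimages of charts under normalization.
theorem IsFaceElement.saturation {σ : X.cones} {τ : PointedCone ℝ (RealSpace N)}
    {a : DualLattice N} (ha : X.IsFaceElement σ τ a) : X.saturation.IsFaceElement σ τ a where
  mem := X.semigroup_le_saturation σ ha.mem
  mem_perp := ha.mem_perp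
  exists_add γ hγ hγτ := by
    obtain ⟨d, hd, h⟩ := X.exists_nsmul_mem_of_mem_saturation hγ
    have hp : d • γ ∈ perp τ := fun v hv ↦ by
      rw [realForm_nsmul, LinearMap.smul_apply, hγτ v hv, smul_zero]
    obtain ⟨n, γ', hγ', e⟩ := ha.exists_add _ h hp
    refine ⟨n, (d - 1) • γ + γ', add_mem (nsmul_mem hγ _) (X.semigroup_le_saturation σ hγ'), ?_⟩
    rw [← e, ← add_assoc]
    congr 1
    obtain ⟨d, rfl⟩ := Nat.exists_eq_succ_of_ne_zero hd.ne'
    rw [Nat.succ_sub_one, succ_nsmul, add_comm]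

variable {X X'} in
-- A positive multiple of `m` lies in `Γ_σ`, so a positive multiple of `φ^* m` lies in `Γ'_{σ'}`;
-- dual cones are saturated.
theorem dualMap_mem_latticePoints [Module.Free ℤ N'] [Module.Finite ℤ N'] {φs : N' →ₗ[ℤ] N}
    {σ' : X'.cones} {σ : X.cones} (h : ∀ m ∈ X.semigroup σ, φs.dualMap m ∈ X'.semigroup σ') :
    ∀ m ∈ latticePoints σ.1, φs.dualMap m ∈ latticePoints σ'.1 := fun m hm ↦ by
  obtain ⟨d, hd, hdm⟩ := X.exists_nsmul_mem_of_mem_saturation (σ := σ) hm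
  refine X'.mem_saturation_of_nsmul_mem (σ := σ') hd ?_
  rw [← map_nsmul]
  exact h _ hdm

variable {X X'} in
theorem _root_.ToricSemigroup.IsMapOfFans.saturation [Module.Free ℤ N'] [Module.Finite ℤ N']
    {φs : N' →ₗ[ℤ] N} (h : IsMapOfFans φs X' X) :
    IsMapOfFans φs X'.saturation X.saturation := fun σ' ↦ by
  obtain ⟨σ, hσ⟩ := h σ'
  exact ⟨σ, dualMap_mem_latticePoints (X' := X') (σ' := σ') hσ⟩

end Saturation

end FanWithSemigroups

end Fans

end ToricSemigroup

namespace ToricSemigroup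

/-! ### Homomorphisms of monoids and morphisms of tori -/

section Affine

variable (k : Type u) [Field k]

open MonoidalCategory CartesianMonoidalCategory MonObj

/-- Through the multiplicative bijection `Spec.mapMulEquiv`, products of morphisms into `T^A` can be
computed as convolution products of algebra homomorphisms. -/
theorem affineMap_eq_mapMulEquiv {A B : Type u} [AddCommMonoid A] [AddCommMonoid B] (g : A →+ B) :
    affineMap k g =
      Spec.mapMulEquiv (.toConv (AddMonoidAlgebra.mapDomainAlgHom k k g)) := rfl

theorem affineMap_injective {A B : Type u} [AddCommMonoid A] [AddCommMonoid B] :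
    Function.Injective (affineMap k : (A →+ B) → _) := by
  intro g h e
  rw [affineMap_eq_mapMulEquiv, affineMap_eq_mapMulEquiv] at e
  have e' := (WithConv.toConv_injective (Spec.mapMulEquiv.injective e))
  ext a
  have := DFunLike.congr_fun e' (AddMonoidAlgebra.single a 1)
  rw [AddMonoidAlgebra.mapDomainAlgHom_apply, AddMonoidAlgebra.mapDomainAlgHom_apply,
    AddMonoidAlgebra.mapDomain_single, AddMonoidAlgebra.mapDomain_single] at this
  exact AddMonoidAlgebra.single_left_injective one_ne_zero this

/-- Products of morphisms to `T^A` correspond to sums of homomorphisms. -/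
theorem lift_affineMap_mul {A B : Type u} [AddCommMonoid A] [AddCommMonoid B] (g h : A →+ B) :
    lift (affineMap k g) (affineMap k h) ≫ μ = affineMap k (g + h) := by
  change affineMap k g * affineMap k h = _
  rw [affineMap_eq_mapMulEquiv, affineMap_eq_mapMulEquiv, affineMap_eq_mapMulEquiv, ← map_mul]
  congr 1
  apply WithConv.ofConv_injective
  ext a
  simp [AlgHom.convMul_apply]

/-- A homomorphism of tori is a bialgebra homomorphism `k[t^M] → k[t^{M'}]`. It preserves group-like
elements, which are the monomials, so it comes from a homomorphism `M → M'`. Lattices are reflexive,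
so this is the dual of a unique `N' → N`. -/
theorem existsUnique_torusMap_eq {N N' : Type u} [AddCommGroup N] [Module.Free ℤ N]
    [Module.Finite ℤ N] [AddCommGroup N'] [Module.Free ℤ N'] [Module.Finite ℤ N']
    (φ : torus k N' ⟶ torus k N) [IsMonHom φ] :
    ∃! φs : N' →ₗ[ℤ] N, torusMap k φs = φ := by
  obtain ⟨g, rfl⟩ : ∃ g : DualLattice N →+ DualLattice N', affineMap k g = φ := by
    let Φ : (bialgSpec (.of k)).obj (.op (CommBialgCat.of k (AddMonoidAlgebra k (DualLattice N')))) ⟶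
        (bialgSpec (.of k)).obj (.op (CommBialgCat.of k (AddMonoidAlgebra k (DualLattice N)))) :=
      { hom := φ, isMonHom_hom := ‹IsMonHom φ› }
    let F := (bialgSpec.fullyFaithful (R := .of k)).preimage Φ
    let f := F.unop.hom
    refine ⟨AddMonoidAlgebra.mapDomainOfBialgHom f, ?_⟩
    have h1 : (bialgSpec (.of k)).map F = Φ := Functor.FullyFaithful.map_preimage _ _
    have h2 : (bialgSpec (.of k)).map
      (.op (CommBialgCat.ofHom (AddMonoidAlgebra.mapDomainBialgHom k
        (AddMonoidAlgebra.mapDomainOfBialgHom f)))) = Φ := by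
      rw [AddMonoidAlgebra.mapDomainBialgHom_mapDomainOfBialgHom]
      exact h1
    exact congrArg Mon.Hom.hom h2
  have hd : ∀ φs : N' →ₗ[ℤ] N, torusMap k φs = affineMap k g ↔
      φs.dualMap.toAddMonoidHom = g := fun φs ↦ (affineMap_injective k).eq_iff
  simp_rw [hd]
  let g' : DualLattice N →ₗ[ℤ] DualLattice N' := g.toIntLinearMap
  -- The dual of `g`, transported along the identifications of `N` and `N'` with their double duals.
  refine ⟨(Module.evalEquiv ℤ N).symm.toLinearMap ∘ₗ g'.dualMap ∘ₗ (Module.evalEquiv ℤ N').toLinearMap,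
    ?_, fun φs h ↦ ?_⟩
  · ext m n
    simp [g']
  · ext n
    apply (Module.evalEquiv ℤ N).injective
    ext m
    have := DFunLike.congr_fun (DFunLike.congr_fun h m) n
    simpa [g'] using this

end Affine

end ToricSemigroup

namespace ToricSemigroup

/-! ### The torus action and the glued morphism -/

section Equivariance

variable (k : Type u) [Field k]

open MonoidalCategory CartesianMonoidalCategory MonObj

theorem affineMap_zero {A B : Type u} [AddCommMonoid A] [AddCommMonoid B] :
    affineMap k (0 : A →+ B) = 1 := by
  rw [affineMap_eq_mapMulEquiv, ← map_one Spec.mapMulEquiv]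
  congr 1
  apply WithConv.ofConv_injective
  ext a
  simp

variable {N N' : Type u} [AddCommGroup N] [AddCommGroup N']

/-- The action becomes multiplication in the monoid of `Y`-points of `T^S`, where identities about
it can be computed. -/
theorem lift_affineAction {Y : Over (base k)} (S : AddSubmonoid (DualLattice N))
    (a : Y ⟶ torus k N) (b : Y ⟶ affineScheme k S) :
    lift a b ≫ affineAction k S = (a ≫ affineMap k S.subtype) * b := by
  rw [affineAction, lift_whiskerRight_assoc]
  rfl

theorem lift_affineMap_affineAction {B : Type u} [AddCommMonoid B]
    (S : AddSubmonoid (DualLattice N)) (g : DualLattice N →+ B) (h : S →+ B) :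
    lift (affineMap k g) (affineMap k h) ≫ affineAction k S =
      affineMap k (g.comp S.subtype + h) := by
  rw [lift_affineAction, affineMap_comp]
  exact lift_affineMap_mul k _ _

/-- `t⁻¹ · (t · x) = x`. -/
theorem lift_neg_affineAction (S : AddSubmonoid (DualLattice N)) :
    lift (fst _ _ ≫ affineMap k (-AddMonoidHom.id (DualLattice N))) (affineAction k S) ≫
      affineAction k S = snd _ _ := by
  have h1 : affineAction k S = (fst _ _ ≫ affineMap k S.subtype) * snd _ _ := by
    rw [← lift_affineAction, lift_fst_snd, Category.id_comp]
  rw [lift_affineAction]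
  conv_lhs => rw [h1]
  rw [← _root_.mul_assoc, Category.assoc, ← MonObj.comp_mul, affineMap_comp]
  have h2 : affineMap k ((-AddMonoidHom.id (DualLattice N)).comp S.subtype) *
      affineMap k S.subtype = 1 := by
    refine (lift_affineMap_mul k _ _).trans ?_
    rw [← affineMap_zero]
    congr 1
    ext; simp
  rw [h2, MonObj.comp_one, _root_.one_mul]

/-- The action is multiplication after restriction along `S ⊆ M`, and a morphism given by a
homomorphism of semigroups respects multiplication. -/
theorem tensorHom_affineMap_affineAction (φs : N' →ₗ[ℤ] N) {S : AddSubmonoid (DualLattice N)}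
    {S' : AddSubmonoid (DualLattice N')} (h : ∀ m ∈ S, φs.dualMap m ∈ S') :
    (torusMap k φs ⊗ₘ affineMap k (restrictDual φs h)) ≫ affineAction k S =
      affineAction k S' ≫ affineMap k (restrictDual φs h) := by
  have h1 : torusMap k φs ≫ affineMap k S.subtype =
      affineMap k S'.subtype ≫ affineMap k (restrictDual φs h) := by
    rw [torusMap, affineMap_comp, affineMap_comp]
    rfl
  have h2 := IsMonHom.mul_hom (f := affineMap k (restrictDual φs h))
  rw [affineAction, affineAction, Category.assoc, h2]
  simp only [← MonoidalCategory.tensorHom_id, tensorHom_comp_tensorHom_assoc, h1,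
    Category.id_comp, Category.comp_id]

namespace FanWithSemigroups

variable (X : FanWithSemigroups N) (X' : FanWithSemigroups N')

theorem variety_hom_ext {Y : Over (base k)} {f g : X.variety k ⟶ Y}
    (h : ∀ σ, X.ι k σ ≫ f = X.ι k σ ≫ g) : f = g := by
  apply Over.OverMorphism.ext
  exact Limits.colimit.hom_ext fun σ ↦ congrArg Over.Hom.left (h σ)

theorem torus_prod_variety_hom_ext {Y : Over (base k)} {f g : torus k N ⊗ X.variety k ⟶ Y}
    (h : ∀ σ, torus k N ◁ X.ι k σ ≫ f = torus k N ◁ X.ι k σ ≫ g) : f = g := by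
  have h1 (σ : X.cones) : X.prodPieceι k σ ≫ f = X.prodPieceι k σ ≫ g := by
    rw [← toTorusProdChart_whiskerLeft_ι, Category.assoc, Category.assoc, h σ]
  apply Over.OverMorphism.ext
  exact Scheme.Cover.hom_ext (X.prodCover k) _ _ fun σ ↦ congrArg Over.Hom.left (h1 σ)

/-- The morphism `(t, x) ↦ (t⁻¹, t · x)`. -/
noncomputable def shear : torus k N ⊗ X.variety k ⟶ torus k N ⊗ X.variety k :=
  lift (fst _ _ ≫ affineMap k (-AddMonoidHom.id (DualLattice N))) (X.action k)

theorem shear_snd : X.shear k ≫ snd _ _ = X.action k := lift_snd _ _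

/-- Since `t⁻¹ · (t · x) = x`, the shear exchanges the action and the second projection. This
transfers statements about the projection, whose preimages of charts are known, to the action. -/
theorem shear_action : X.shear k ≫ X.action k = snd _ _ := by
  refine X.torus_prod_variety_hom_ext k fun σ ↦ ?_
  have h1 : torus k N ◁ X.ι k σ ≫ X.shear k =
      lift (fst _ _ ≫ affineMap k (-AddMonoidHom.id (DualLattice N)))
        (affineAction k (X.semigroup σ)) ≫ torus k N ◁ X.ι k σ := by
    rw [shear, comp_lift, whiskerLeft_ι_action, lift_whiskerLeft, whiskerLeft_fst_assoc]
  rw [← Category.assoc, h1, Category.assoc, whiskerLeft_ι_action, ← Category.assoc,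
    lift_neg_affineAction, whiskerLeft_snd]

variable {X X'} {k}

/-- Two charts that contain the image of a chart induce the same morphism. -/
theorem affineMap_restrictDual_ι {φs : N' →ₗ[ℤ] N} {σ' : X'.cones} {σ τ : X.cones}
    (hσ : ∀ m ∈ X.semigroup σ, φs.dualMap m ∈ X'.semigroup σ')
    (hτ : ∀ m ∈ X.semigroup τ, φs.dualMap m ∈ X'.semigroup σ') :
    affineMap k (restrictDual φs hσ) ≫ X.ι k σ = affineMap k (restrictDual φs hτ) ≫ X.ι k τ := by
  have h := dualMap_mem_inter hσ hτ
  -- Each of the two morphisms is compared with the one through the chart of `σ ∩ τ`.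
  have key : ∀ (ρ : X.cones) (hρ : ∀ m ∈ X.semigroup ρ, φs.dualMap m ∈ X'.semigroup σ')
      (_ : X.inter σ τ ≤ ρ), affineMap k (restrictDual φs hρ) ≫ X.ι k ρ =
        affineMap k (restrictDual φs h) ≫ X.ι k (X.inter σ τ) := by
    intro ρ hρ hle
    rw [← X.inclusionMap_ι k hle, inclusionMap, ← Category.assoc, affineMap_comp]
    rfl
  rw [key σ hσ (X.inter_le_left σ τ), key τ hτ (X.inter_le_right σ τ)]

theorem existsUnique_isInduced {φs : N' →ₗ[ℤ] N} (h : IsMapOfFans φs X' X) :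
    ∃! f : X'.variety k ⟶ X.variety k, IsInduced k φs f := by
  choose s hs using h
  refine ⟨X'.desc k (fun σ' ↦ affineMap k (restrictDual φs (hs σ')) ≫ X.ι k (s σ'))
    (fun {σ' τ'} hle ↦ ?_), fun σ' σ hσ ↦ ?_, fun f hf ↦ ?_⟩
  -- On the chart of the face `τ'` there are two candidates, through `s τ'` and through `s σ'`;
  -- independence of the chosen chart identifies them.
  · have h' : ∀ m ∈ X.semigroup (s σ'), φs.dualMap m ∈ X'.semigroup τ' := fun m hm ↦
      X'.semigroup_mono hle (hs σ' m hm)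
    rw [affineMap_restrictDual_ι (hs τ') h', inclusionMap, ← Category.assoc, affineMap_comp]
    rfl
  · rw [ι_desc]
    exact affineMap_restrictDual_ι _ _
  · refine X'.variety_hom_ext k fun σ' ↦ ?_
    rw [ι_desc]
    exact hf σ' _ _

/-- One target chart for each `σ'` is enough, since any other admissible chart induces the same
morphism. -/
theorem isInduced_of_exists {φs : N' →ₗ[ℤ] N} {f : X'.variety k ⟶ X.variety k}
    (h : ∀ σ' : X'.cones, ∃ (σ : X.cones)
      (hσ : ∀ m ∈ X.semigroup σ, φs.dualMap m ∈ X'.semigroup σ'),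
      X'.ι k σ' ≫ f = affineMap k (restrictDual φs hσ) ≫ X.ι k σ) : IsInduced k φs f := by
  intro σ' τ hτ
  obtain ⟨σ, hσ, e⟩ := h σ'
  rw [e, affineMap_restrictDual_ι hσ hτ]

theorem _root_.ToricSemigroup.IsInduced.extends {φs : N' →ₗ[ℤ] N} (h : IsMapOfFans φs X' X)
    {f : X'.variety k ⟶ X.variety k} (hf : IsInduced k φs f) : Extends (torusMap k φs) f := by
  obtain ⟨σ, hσ⟩ := h X'.zeroCone
  rw [Extends, ← X.affineMap_subtype_ι k σ, torusEmb, Category.assoc, hf _ σ hσ,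
    ← Category.assoc, ← Category.assoc, affineMap_comp, torusMap, affineMap_comp]
  rfl

theorem _root_.ToricSemigroup.IsInduced.isEquivariant {φs : N' →ₗ[ℤ] N}
    (h : IsMapOfFans φs X' X) {f : X'.variety k ⟶ X.variety k} (hf : IsInduced k φs f) :
    IsEquivariant (torusMap k φs) f := by
  refine X'.torus_prod_variety_hom_ext k fun σ' ↦ ?_
  obtain ⟨σ, hσ⟩ := h σ'
  have h1 : torus k N' ◁ X'.ι k σ' ≫ (torusMap k φs ⊗ₘ f) =
      (torusMap k φs ⊗ₘ affineMap k (restrictDual φs hσ)) ≫ torus k N ◁ X.ι k σ := by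
    simp only [← MonoidalCategory.id_tensorHom, tensorHom_comp_tensorHom, Category.id_comp,
      Category.comp_id, hf σ' σ hσ]
  rw [← Category.assoc, h1, Category.assoc, whiskerLeft_ι_action, ← Category.assoc,
    tensorHom_affineMap_affineAction, ← Category.assoc, whiskerLeft_ι_action, Category.assoc,
    Category.assoc, hf σ' σ hσ]

end FanWithSemigroups

end Equivariance

end ToricSemigroup

namespace ToricSemigroup

/-! ### Orbits and specializations in an affine chart -/

section Points

variable (k : Type u) [Field k]

section UnitPoint

variable (A : Type u) [AddCommMonoid A]

open Classical in
/-- The homomorphism of `A` to the multiplicative monoid of `k` that is `1` on the units and `0`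
elsewhere. -/
noncomputable def unitCharacter : Multiplicative A →* k where
  toFun a := if IsAddUnit a.toAdd then 1 else 0
  map_one' := if_pos isAddUnit_zero
  map_mul' a b := by
    simp only [toAdd_mul, IsAddUnit.add_iff, ite_and, mul_ite, mul_one, mul_zero]
    split_ifs <;> rfl

/-- The point of `T^A` at which `t^a` vanishes precisely for the non-units `a` of `A`. -/
noncomputable def unitPoint : PrimeSpectrum (AddMonoidAlgebra k A) :=
  ⟨RingHom.ker (AddMonoidAlgebra.lift k k A (unitCharacter k A)), RingHom.ker_isPrime _⟩

variable {A k}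

theorem mem_unitPoint {f : AddMonoidAlgebra k A} (h : ∀ a ∈ f.coeff.support, ¬ IsAddUnit a) :
    f ∈ (unitPoint k A).asIdeal := by
  change AddMonoidAlgebra.lift k k A (unitCharacter k A) f = 0
  rw [AddMonoidAlgebra.lift_apply]
  refine Finset.sum_eq_zero fun a ha ↦ ?_
  have : unitCharacter k A (Multiplicative.ofAdd a) = 0 := if_neg (h a ha)
  exact (congrArg (f.coeff a • ·) this).trans (smul_zero _)

theorem single_notMem {y : Ideal (AddMonoidAlgebra k A)} (hy : y.IsPrime) {a : A}
    (ha : AddMonoidAlgebra.single a (1 : k) ∈ y) : ¬ IsAddUnit a := by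
  rintro ⟨u, rfl⟩
  refine hy.ne_top (y.eq_top_of_isUnit_mem ha
    (IsUnit.of_mul_eq_one (AddMonoidAlgebra.single (-u).val 1) ?_))
  rw [AddMonoidAlgebra.single_mul_single, u.add_neg, mul_one, AddMonoidAlgebra.one_def]

end UnitPoint

variable {k} {M : Type u} [AddCommGroup M] (S : AddSubmonoid M)

/-- The homomorphism `(m, s) ↦ t^s(y) t^m`, whose kernel is the generic point of the fibre of
`T^M × T^S` over the point `y` of `T^S`. -/
noncomputable def orbitHom (y : Ideal (AddMonoidAlgebra k S)) :
    AddMonoidAlgebra k (M × S) →ₐ[k] AddMonoidAlgebra (AddMonoidAlgebra k S ⧸ y) M :=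
  AddMonoidAlgebra.lift k _ _
    { toFun := fun a ↦ AddMonoidAlgebra.single a.toAdd.1
        (Ideal.Quotient.mk y (AddMonoidAlgebra.single a.toAdd.2 1))
      map_one' := by
        rw [AddMonoidAlgebra.one_def]
        congr 1
      map_mul' := fun a b ↦ by
        rw [AddMonoidAlgebra.single_mul_single, ← map_mul, AddMonoidAlgebra.single_mul_single,
          mul_one]
        rfl }

theorem orbitHom_single (y : Ideal (AddMonoidAlgebra k S)) (a : M × S) (r : k) :
    orbitHom S y (AddMonoidAlgebra.single a r) =
      AddMonoidAlgebra.single a.1 (Ideal.Quotient.mk y (AddMonoidAlgebra.single a.2 r)) := by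
  rw [orbitHom, AddMonoidAlgebra.lift_single]
  change r • AddMonoidAlgebra.single a.1 (Ideal.Quotient.mk y (AddMonoidAlgebra.single a.2 1)) = _
  rw [AddMonoidAlgebra.smul_single, ← Ideal.Quotient.mkₐ_eq_mk k, ← map_smul,
    AddMonoidAlgebra.smul_single, smul_eq_mul, mul_one]

/-- The kernel of `orbitHom` thereby contracts to `y` along the second projection. -/
theorem orbitHom_inr (y : Ideal (AddMonoidAlgebra k S)) (f : AddMonoidAlgebra k S) :
    orbitHom S y (AddMonoidAlgebra.mapDomain (AddMonoidHom.inr M S) f) =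
      AddMonoidAlgebra.single 0 (Ideal.Quotient.mk y f) := by
  induction f using AddMonoidAlgebra.induction_linear with
  | zero => simp
  | add f g hf hg => rw [AddMonoidAlgebra.mapDomain_add, map_add, hf, hg, map_add,
      AddMonoidAlgebra.single_add]
  | single s r => rw [AddMonoidAlgebra.mapDomain_single, orbitHom_single]; rfl

/-- The action sends `t^s` to `t^s ⊗ t^s`, so distinct monomials land in distinct degrees and cannot
cancel: a function vanishing at the generic translate of `y` has each of its terms in `y`. -/
theorem coeff_orbitHom_diag (y : Ideal (AddMonoidAlgebra k S)) (f : AddMonoidAlgebra k S) (s : S) :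
    (orbitHom S y (AddMonoidAlgebra.mapDomain (S.subtype.prod (AddMonoidHom.id S)) f)).coeff s.1 =
      Ideal.Quotient.mk y (AddMonoidAlgebra.single s (f.coeff s)) := by
  classical
  induction f using AddMonoidAlgebra.induction_linear with
  | zero => simp
  | add f g hf hg =>
    rw [AddMonoidAlgebra.mapDomain_add, map_add, AddMonoidAlgebra.coeff_add, Finsupp.add_apply, hf,
      hg, AddMonoidAlgebra.coeff_add, Finsupp.add_apply, AddMonoidAlgebra.single_add, map_add]
  | single a r =>
    rw [AddMonoidAlgebra.mapDomain_single, orbitHom_single, AddMonoidAlgebra.coeff_single,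
      AddMonoidAlgebra.coeff_single, Finsupp.single_apply, Finsupp.single_apply]
    by_cases h : a = s
    · subst h
      simp
    · have : ¬ a.1 = s.1 := fun e ↦ h (Subtype.ext e)
      simp [h, this]

/-- Each point `y` of `T^S` has a translate, under the point `p` of `T^M × T^S`, that specializes
to `unitPoint`. -/
theorem exists_orbit_point [UniqueSums M] (y : (affineScheme k S).left) :
    ∃ p : (affineScheme k (M × S)).left, (affineMap k (AddMonoidHom.inr M S)).left p = y ∧
      (affineMap k (S.subtype.prod (AddMonoidHom.id S))).left p ⤳
        (show (affineScheme k S).left from unitPoint k S) := by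
  let y' : PrimeSpectrum (AddMonoidAlgebra k S) := y
  have := y'.isPrime
  -- The kernel is prime because `M` has unique sums, so the group algebra over the domain `k[t^S] ⧸
  -- y` is a domain.
  let p : PrimeSpectrum (AddMonoidAlgebra k (M × S)) :=
    ⟨RingHom.ker (orbitHom S y'.asIdeal), RingHom.ker_isPrime _⟩
  refine ⟨p, ?_, ?_⟩
  · refine PrimeSpectrum.ext (Ideal.ext fun f ↦ ?_)
    change orbitHom S y'.asIdeal (AddMonoidAlgebra.mapDomain (AddMonoidHom.inr M S) f) = 0 ↔
      f ∈ y'.asIdeal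
    rw [orbitHom_inr, AddMonoidAlgebra.single_eq_zero, Ideal.Quotient.eq_zero_iff_mem]
  -- Specialization is inclusion of ideals. A monomial in the prime `y` has a non-unit exponent, so
  -- it also vanishes at `unitPoint`.
  · refine (PrimeSpectrum.le_iff_specializes _ (unitPoint k S)).mp fun f hf ↦ ?_
    replace hf : orbitHom S y'.asIdeal
      (AddMonoidAlgebra.mapDomain (S.subtype.prod (AddMonoidHom.id S)) f) = 0 := hf
    refine mem_unitPoint fun s hs ↦ single_notMem y'.isPrime ?_
    have h1 := coeff_orbitHom_diag S y'.asIdeal f s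
    rw [hf, AddMonoidAlgebra.coeff_zero, Finsupp.zero_apply, eq_comm,
      Ideal.Quotient.eq_zero_iff_mem] at h1
    -- Dividing the term by its nonzero coefficient leaves the monomial.
    have h2 := Ideal.mul_mem_left _ (AddMonoidAlgebra.single 0 (f.coeff s)⁻¹) h1
    rwa [AddMonoidAlgebra.single_mul_single, zero_add,
      inv_mul_cancel₀ (Finsupp.mem_support_iff.mp hs)] at h2

end Points

end ToricSemigroup

namespace ToricSemigroup

/-! ### Equivariant extensions are induced by maps of fans -/

section Converse

open MonoidalCategory CartesianMonoidalCategory MonObj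

variable {N N' : Type u} [AddCommGroup N] [AddCommGroup N']

theorem affineMap_mapMulEquiv (k : Type u) [Field k] {A B C : Type u} [AddCommMonoid A]
    [AddCommMonoid B] [AddCommMonoid C] (h : B →+ C)
    (α : AddMonoidAlgebra k A →ₐ[k] AddMonoidAlgebra k B) :
    affineMap k h ≫ (Spec.mapMulEquiv (.toConv α) : affineScheme k B ⟶ affineScheme k A) =
      Spec.mapMulEquiv (.toConv ((AddMonoidAlgebra.mapDomainAlgHom k k h).comp α)) := by
  ext1
  change Spec.map _ ≫ Spec.map _ = Spec.map (CommRingCat.ofHom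
    ((AddMonoidAlgebra.mapDomainAlgHom k k h).comp α).toRingHom)
  rw [← Spec.map_comp]
  rfl

/-- A morphism `T^{S'} ⟶ T^S` that restricts to `t^m ↦ t^(φ^* m)` on the tori is given by
`t^m ↦ t^(φ^* m)`. -/
theorem eq_affineMap_restrictDual {k : Type u} [Field k] (φs : N' →ₗ[ℤ] N)
    {S : AddSubmonoid (DualLattice N)} {S' : AddSubmonoid (DualLattice N')}
    (g : affineScheme k S' ⟶ affineScheme k S)
    (hg : affineMap k S'.subtype ≫ g = torusMap k φs ≫ affineMap k S.subtype) :
    ∃ h : ∀ m ∈ S, φs.dualMap m ∈ S', g = affineMap k (restrictDual φs h) := by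
  obtain ⟨⟨α⟩, rfl⟩ := Spec.mapMulEquiv.surjective g
  have e : (AddMonoidAlgebra.mapDomainAlgHom k k S'.subtype).comp α =
      AddMonoidAlgebra.mapDomainAlgHom k k (φs.dualMap.toAddMonoidHom.comp S.subtype) := by
    rw [torusMap, affineMap_comp, affineMap_eq_mapMulEquiv k (φs.dualMap.toAddMonoidHom.comp _)]
      at hg
    have h1 := (affineMap_mapMulEquiv k S'.subtype α).symm.trans hg
    exact WithConv.toConv_injective (Spec.mapMulEquiv.injective h1)
  have e' : ∀ m : S, AddMonoidAlgebra.mapDomain S'.subtype (α (AddMonoidAlgebra.single m 1)) =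
      AddMonoidAlgebra.single (φs.dualMap m.1) 1 := fun m ↦ by
    have := DFunLike.congr_fun e (AddMonoidAlgebra.single m 1)
    rw [AddMonoidAlgebra.mapDomainAlgHom_apply, AddMonoidAlgebra.mapDomain_single] at this
    exact this
  have h : ∀ m ∈ S, φs.dualMap m ∈ S' := by
    intro m hm
    by_contra hn
    -- The coefficient at `φ^* m` is `1` on the right. On the left it is `0`, because only exponents
    -- from `S'` occur there.
    have h1 := congrArg (fun f ↦ f.coeff (φs.dualMap m)) (e' ⟨m, hm⟩)
    simp only [AddMonoidAlgebra.coeff_single, Finsupp.single_eq_same,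
      AddMonoidAlgebra.coeff_mapDomain] at h1
    rw [Finsupp.mapDomain_of_notMem_range] at h1
    · exact zero_ne_one h1
    · rintro ⟨x, hx⟩
      exact hn (hx ▸ x.2)
  refine ⟨h, ?_⟩
  rw [affineMap_eq_mapMulEquiv]
  congr 2
  ext m
  refine congrArg (fun f ↦ AddMonoidAlgebra.coeff f _) ?_
  apply AddMonoidAlgebra.mapDomain_injective (f := S'.subtype) Subtype.val_injective
  refine (e' m).trans ?_
  simp [restrictDual]
  rfl

namespace FanWithSemigroups

variable {k : Type u} [Field k] {X : FanWithSemigroups N} {X' : FanWithSemigroups N'}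

theorem exists_mem_range_ι (x : (X.variety k).left) : ∃ σ, x ∈ Set.range (X.ι k σ).left :=
  ⟨_, (X.cover k).covers x⟩

/-- Charts are stable under the torus: if `t · x` lies in a chart, so does `x = t⁻¹ · (t · x)`. The
shear expresses this for scheme-theoretic points of the product. -/
theorem mem_range_ι_of_action {σ : X.cones} {z : (torus k N ⊗ X.variety k).left}
    (hz : (X.action k).left z ∈ Set.range (X.ι k σ).left) :
    (snd (torus k N) (X.variety k)).left z ∈ Set.range (X.ι k σ).left := by
  have h1 : (snd (torus k N) (X.variety k)).left ((X.shear k).left z) ∈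
      Set.range ((X.cover k).f σ) := by
    rw [← Scheme.Hom.comp_apply, ← Over.comp_left, shear_snd]
    exact hz
  -- The member of `prodCover` is the preimage of the chart under the second projection.
  have h2 : (X.shear k).left z ∈ Set.range (X.prodPieceι k σ).left := by
    have := Scheme.Pullback.range_fst (f := (snd (torus k N) (X.variety k)).left)
      (g := (X.cover k).f σ)
    exact this.symm ▸ h1
  obtain ⟨v, hv⟩ := h2
  refine ⟨(X.toTorusProdChart k σ ≫ affineAction k (X.semigroup σ)).left v, ?_⟩
  rw [← Scheme.Hom.comp_apply, ← Over.comp_left, Category.assoc, ← prodPieceι_action,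
    Over.comp_left, Scheme.Hom.comp_apply, hv, ← Scheme.Hom.comp_apply, ← Over.comp_left,
    shear_action]

/-- The chart that contains the image of `unitPoint` works, since every point has a translate that
specializes to `unitPoint` and charts are open and torus-stable. -/
theorem range_ι_subset_of_isEquivariant [UniqueSums (DualLattice N')]
    {φ : torus k N' ⟶ torus k N} {f : X'.variety k ⟶ X.variety k} (hf : IsEquivariant φ f)
    (σ' : X'.cones) :
    ∃ σ : X.cones, Set.range (X'.ι k σ' ≫ f).left ⊆ Set.range (X.ι k σ).left := by
  obtain ⟨σ, hσ⟩ := exists_mem_range_ι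
    ((X'.ι k σ' ≫ f).left (show (affineScheme k _).left from unitPoint k (X'.semigroup σ')))
  refine ⟨σ, ?_⟩
  rintro _ ⟨y, rfl⟩
  obtain ⟨p, hp, hs⟩ := exists_orbit_point (X'.semigroup σ') y
  -- `T^{M' × Γ'}` serves as a model of `T^{M'} × T^{Γ'}` whose points are primes of a monoid
  -- algebra; `L` maps it to the product with the toric variety.
  let L := lift (affineMap k (AddMonoidHom.inl (DualLattice N') (X'.semigroup σ')))
    (affineMap k (AddMonoidHom.inr (DualLattice N') (X'.semigroup σ'))) ≫
      torus k N' ◁ X'.ι k σ'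
  have h1 : (L ≫ (φ ⊗ₘ f)) ≫ X.action k =
      affineMap k ((X'.semigroup σ').subtype.prod (AddMonoidHom.id _)) ≫ X'.ι k σ' ≫ f := by
    have hd : (AddMonoidHom.inl (DualLattice N') (X'.semigroup σ')).comp
        (X'.semigroup σ').subtype + AddMonoidHom.inr (DualLattice N') (X'.semigroup σ') =
        (X'.semigroup σ').subtype.prod (AddMonoidHom.id _) := by
      ext <;> simp
    rw [Category.assoc, hf, ← Category.assoc, ← Category.assoc, Category.assoc _ _ (X'.action k),
      whiskerLeft_ι_action, ← Category.assoc, lift_affineMap_affineAction, hd]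
  have h2 : (L ≫ (φ ⊗ₘ f)) ≫ snd _ _ = affineMap k (AddMonoidHom.inr _ _) ≫ X'.ι k σ' ≫ f := by
    simp [L]
  have h3 : (X.action k).left ((L ≫ (φ ⊗ₘ f)).left p) ∈ Set.range (X.ι k σ).left := by
    rw [← Scheme.Hom.comp_apply, ← Over.comp_left, h1, Over.comp_left, Scheme.Hom.comp_apply]
    -- An open set that contains a specialization of a point contains the point.
    exact (hs.map (X'.ι k σ' ≫ f).left.continuous).mem_open
      (X.ι k σ).left.isOpenEmbedding.isOpen_range hσ
  have h4 := mem_range_ι_of_action h3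
  rwa [← Scheme.Hom.comp_apply, ← Over.comp_left, h2, Over.comp_left, Scheme.Hom.comp_apply,
    hp] at h4

/-- Once the image of the chart lies in an open chart, `f` lifts to a morphism of affine schemes,
which its restriction to the torus determines. -/
theorem exists_eq_affineMap_ι [UniqueSums (DualLattice N')] {φs : N' →ₗ[ℤ] N}
    {f : X'.variety k ⟶ X.variety k} (he : Extends (torusMap k φs) f)
    (hf : IsEquivariant (torusMap k φs) f) (σ' : X'.cones) :
    ∃ (σ : X.cones) (h : ∀ m ∈ X.semigroup σ, φs.dualMap m ∈ X'.semigroup σ'),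
      X'.ι k σ' ≫ f = affineMap k (restrictDual φs h) ≫ X.ι k σ := by
  obtain ⟨σ, hσ⟩ := range_ι_subset_of_isEquivariant hf σ'
  let g : affineScheme k (X'.semigroup σ') ⟶ affineScheme k (X.semigroup σ) :=
    Over.homMk (IsOpenImmersion.lift (X.ι k σ).left (X'.ι k σ' ≫ f).left hσ) (by
      rw [← Over.w (X.ι k σ), ← Category.assoc, IsOpenImmersion.lift_fac, Over.w])
  have hg : g ≫ X.ι k σ = X'.ι k σ' ≫ f := by
    apply Over.OverMorphism.ext
    exact IsOpenImmersion.lift_fac _ _ _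
  obtain ⟨h, e⟩ := eq_affineMap_restrictDual φs g (by
    rw [← cancel_mono (X.ι k σ), Category.assoc, hg, ← Category.assoc, affineMap_subtype_ι,
      Category.assoc, affineMap_subtype_ι]
    exact he)
  exact ⟨σ, h, by rw [← hg, e]⟩

theorem isMapOfFans_and_isInduced [UniqueSums (DualLattice N')] {φs : N' →ₗ[ℤ] N}
    {f : X'.variety k ⟶ X.variety k} (he : Extends (torusMap k φs) f)
    (hf : IsEquivariant (torusMap k φs) f) : IsMapOfFans φs X' X ∧ IsInduced k φs f := by
  refine ⟨fun σ' ↦ ?_, isInduced_of_exists fun σ' ↦ exists_eq_affineMap_ι he hf σ'⟩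
  obtain ⟨σ, h, -⟩ := exists_eq_affineMap_ι he hf σ'
  exact ⟨σ, h⟩

end FanWithSemigroups

end Converse

end ToricSemigroup

namespace ToricSemigroup

/-! ### Integrally closed semigroup algebras -/

section Normality

variable (k : Type u) [Field k] {M : Type u} [AddCommGroup M]

section Weight

variable {k}

/-- The homomorphism `t^m ↦ t^m T^{n(m)}` for a weight `n : M → ℤ`. -/
noncomputable def weightHom (n : M →+ ℤ) :
    AddMonoidAlgebra k M →+* HahnSeries ℤ (AddMonoidAlgebra k M) :=
  AddMonoidAlgebra.liftNCRingHom (HahnSeries.C.comp (algebraMap k (AddMonoidAlgebra k M)))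
    { toFun := fun m ↦ HahnSeries.single (n m.toAdd) (AddMonoidAlgebra.single m.toAdd 1)
      map_one' := by
        rw [toAdd_one, map_zero]
        rfl
      map_mul' := fun a b ↦ by
        rw [HahnSeries.single_mul_single, AddMonoidAlgebra.single_mul_single, toAdd_mul, map_add,
          mul_one] }
    fun _ _ ↦ Commute.all _ _

theorem weightHom_single (n : M →+ ℤ) (m : M) (r : k) :
    weightHom n (AddMonoidAlgebra.single m r) =
      HahnSeries.single (n m) (AddMonoidAlgebra.single m r) := by
  refine (AddMonoidAlgebra.liftNCRingHom_single _ _ _ m r).trans ?_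
  change HahnSeries.single 0 (AddMonoidAlgebra.single 0 r) *
    HahnSeries.single (n m) (AddMonoidAlgebra.single m 1) = _
  rw [HahnSeries.single_mul_single, AddMonoidAlgebra.single_mul_single, zero_add, zero_add,
    mul_one]

/-- Keeping `t^m` next to `T^{n(m)}` prevents cancellation between monomials of equal weight, so
every exponent of `x` is seen by the order in `T`. -/
theorem coeff_weightHom (n : M →+ ℤ) (x : AddMonoidAlgebra k M) (m : M) :
    ((weightHom n x).coeff (n m)).coeff m = x.coeff m := by
  classical
  induction x using AddMonoidAlgebra.induction_linear with
  | zero => simp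
  | add f g hf hg => simp [hf, hg]
  | single a r =>
    rw [weightHom_single, HahnSeries.coeff_single, AddMonoidAlgebra.coeff_single]
    by_cases h : a = m
    · subst h
      simp
    · rw [Finsupp.single_eq_of_ne' h]
      split_ifs
      · rw [AddMonoidAlgebra.coeff_single, Finsupp.single_eq_of_ne' h]
      · simp

/-- The exponents of an element of `k[t^M]` that is integral over `k[t^S]` lie in each half-space
that contains `S`. -/
theorem nonneg_of_isIntegralElem [UniqueSums M] {S : AddSubmonoid M} (n : M →+ ℤ)
    (hS : ∀ m ∈ S, 0 ≤ n m) {x : AddMonoidAlgebra k M}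
    (hx : (AddMonoidAlgebra.mapDomainAlgHom k k S.subtype).toRingHom.IsIntegralElem x) {m : M}
    (hm : x.coeff m ≠ 0) : 0 ≤ n m := by
  let v := (HahnSeries.addVal ℤ (AddMonoidAlgebra k M)).toValuation
  -- Passing from an additive valuation to a `Valuation` reverses the order, so the ring of integers
  -- consists of the series of nonnegative order.
  have hv : ∀ y, v y ≤ 1 ↔ 0 ≤ y.orderTop := fun y ↦ by
    rw [← HahnSeries.addVal_apply]
    exact Iff.rfl
  have h1 : ∀ y : AddMonoidAlgebra k S,
      weightHom n (AddMonoidAlgebra.mapDomain S.subtype y) ∈ v.integer := by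
    intro y
    induction y using AddMonoidAlgebra.induction_linear with
    | zero => rw [AddMonoidAlgebra.mapDomain_zero, map_zero]; exact zero_mem _
    | add f g hf hg =>
      rw [AddMonoidAlgebra.mapDomain_add, map_add]
      exact add_mem hf hg
    | single s r =>
      rw [AddMonoidAlgebra.mapDomain_single, weightHom_single]
      refine (hv _).mpr (le_trans ?_ HahnSeries.orderTop_single_le)
      exact_mod_cast hS s.1 s.2
  let := (AddMonoidAlgebra.mapDomainAlgHom k k S.subtype).toRingHom.toAlgebra
  -- `weightHom` carries `k[t^S]` into the valuation's ring of integers, which contains every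
  -- element integral over it.
  have h2 : IsIntegral (AddMonoidAlgebra k S) x := hx
  have h3 : IsIntegral v.integer (weightHom n x) :=
    IsIntegral.map_of_comp_eq
      (((weightHom n).comp
        (AddMonoidAlgebra.mapDomainAlgHom k k S.subtype).toRingHom).codRestrict v.integer h1)
      (weightHom n) rfl h2
  have h4 := (hv _).mp ((Valuation.integer.integers v).mem_of_integral h3)
  have h5 : (weightHom n x).coeff (n m) ≠ 0 := fun h ↦ hm (by
    rw [← coeff_weightHom n, h]
    rfl)
  exact_mod_cast h4.trans (HahnSeries.orderTop_le_of_coeff_ne_zero h5)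

end Weight

instance isDomain_addMonoidAlgebra [UniqueSums M] (S : AddSubmonoid M) :
    IsDomain (AddMonoidAlgebra k S) :=
  Function.Injective.isDomain (AddMonoidAlgebra.mapDomainAlgHom k k S.subtype).toRingHom
    (AddMonoidAlgebra.mapDomain_injective (f := S.subtype) Subtype.val_injective)

/-- A basis of `M` identifies `k[t^M]` with the Laurent polynomials, a localization of the
polynomial ring, which is integrally closed. -/
theorem isIntegrallyClosed_addMonoidAlgebra [Module.Free ℤ M] [Module.Finite ℤ M]
    [UniqueSums M] : IsIntegrallyClosed (AddMonoidAlgebra k M) := by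
  let b := Module.Free.chooseBasis ℤ M
  let ι := Module.Free.ChooseBasisIndex ℤ M
  let g : (ι →₀ ℕ) →+ M := b.repr.symm.toLinearMap.toAddMonoidHom.comp
    (Finsupp.mapRange.addMonoidHom (Nat.castAddMonoidHom ℤ))
  have hg : Function.Injective g :=
    b.repr.symm.injective.comp (Finsupp.mapRange_injective _ (map_zero _) Nat.cast_injective)
  have hgr : ∀ m : M, (∀ i, 0 ≤ b.repr m i) → m ∈ AddMonoidHom.mrange g := by
    intro m hm
    refine ⟨(b.repr m).mapRange Int.toNat rfl, ?_⟩
    apply b.repr.injective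
    ext i
    simp [g, hm i]
  let e : (ι →₀ ℕ) ≃+ AddMonoidHom.mrange g :=
    AddEquiv.ofBijective g.mrangeRestrict ⟨fun x y h ↦ hg (congrArg Subtype.val h),
      g.mrangeRestrict_surjective⟩
  have : IsIntegrallyClosed (AddMonoidAlgebra k (AddMonoidHom.mrange g)) :=
    IsIntegrallyClosed.of_equiv
      (show MvPolynomial ι k ≃+* _ from (AddMonoidAlgebra.domCongr k k e).toRingEquiv)
  -- The exponent of the product of all variables; inverting this single monomial inverts every
  -- variable.
  let a : M := ∑ i, b i
  have ha : ∀ i, b.repr a i = 1 := fun i ↦ by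
    simp [a, Finsupp.single_apply]
  have haS : a ∈ AddMonoidHom.mrange g := hgr a fun i ↦ by rw [ha]; exact zero_le_one
  let := (AddMonoidAlgebra.mapDomainAlgHom k k (AddSubmonoid.inclusion
    (le_top : AddMonoidHom.mrange g ≤ ⊤))).toRingHom.toAlgebra
  have hloc := isLocalization_away k (le_top : AddMonoidHom.mrange g ≤ ⊤) a
    haS trivial (fun m _ ↦ by
      -- Any number bounding the absolute values of all coordinates of `m` makes those of `m + n •
      -- a` nonnegative.
      refine ⟨∑ j, (b.repr m j).natAbs, hgr _ fun i ↦ ?_⟩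
      rw [map_add, map_nsmul, Finsupp.add_apply, Finsupp.smul_apply, ha]
      have : (b.repr m i).natAbs ≤ ∑ j, (b.repr m j).natAbs :=
        Finset.single_le_sum (f := fun j ↦ (b.repr m j).natAbs) (fun _ _ ↦ Nat.zero_le _)
          (Finset.mem_univ i)
      simp only [nsmul_eq_mul, mul_one]
      omega)
  have : IsIntegrallyClosed (AddMonoidAlgebra k (⊤ : AddSubmonoid M)) :=
    isIntegrallyClosed_of_isLocalization _ (Submonoid.powers
        (AddMonoidAlgebra.single (⟨a, haS⟩ : AddMonoidHom.mrange g) (1 : k)))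
      (powers_le_nonZeroDivisors_of_noZeroDivisors
        (AddMonoidAlgebra.single_ne_zero.mpr one_ne_zero))
  exact IsIntegrallyClosed.of_equiv (AddMonoidAlgebra.domCongr k k
    (AddSubmonoid.topEquiv (M := M))).toRingEquiv

/-- `k[t^S]` is normal if `S` is the set of lattice points of a rational polyhedral cone. -/
theorem isIntegrallyClosed_of_halfSpaces [Module.Free ℤ M] [Module.Finite ℤ M] [UniqueSums M]
    {S : AddSubmonoid M} (s : Set (M →+ ℤ)) (hS : ∀ m, m ∈ S ↔ ∀ n ∈ s, 0 ≤ n m) :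
    IsIntegrallyClosed (AddMonoidAlgebra k S) := by
  have := isIntegrallyClosed_addMonoidAlgebra k (M := M)
  let := (AddMonoidAlgebra.mapDomainAlgHom k k S.subtype).toRingHom.toAlgebra
  have hinj : Function.Injective
      (algebraMap (AddMonoidAlgebra k S) (AddMonoidAlgebra k M)) :=
    AddMonoidAlgebra.mapDomain_injective (f := S.subtype) Subtype.val_injective
  have : FaithfulSMul (AddMonoidAlgebra k S) (AddMonoidAlgebra k M) :=
    (faithfulSMul_iff_algebraMap_injective _ _).mpr hinj
  -- Each half-space bounds the exponents of an integral element, and together they confine them to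
  -- `S`. Being integrally closed in the integrally closed `k[t^M]` is then enough.
  have : IsIntegrallyClosedIn (AddMonoidAlgebra k S) (AddMonoidAlgebra k M) := by
    refine ⟨hinj, fun {x} ↦ ⟨fun hx ↦ ?_, ?_⟩⟩
    · refine ⟨AddMonoidAlgebra.comapDomain S.subtype Subtype.val_injective x,
        AddMonoidAlgebra.mapDomain_comapDomain (fun m hm ↦ ?_) _⟩
      have hmS : m ∈ S := (hS m).mpr fun n hn ↦
        nonneg_of_isIntegralElem n (fun m' hm' ↦ (hS m').mp hm' n hn) hx
          (Finsupp.mem_support_iff.mp hm)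
      exact ⟨⟨m, hmS⟩, rfl⟩
    · rintro ⟨y, rfl⟩
      exact isIntegral_algebraMap
  exact IsIntegrallyClosed.of_isIntegrallyClosed_of_isIntegrallyClosedIn _ (AddMonoidAlgebra k M)

end Normality

end ToricSemigroup

namespace ToricSemigroup

/-! ### The normalization morphism -/

section Normalization

variable {N : Type u} [AddCommGroup N]

namespace FanWithSemigroups

variable (X : FanWithSemigroups N) (k : Type u) [Field k]

instance isIntegral_affineScheme [UniqueSums (DualLattice N)] (S : AddSubmonoid (DualLattice N)) :
    AlgebraicGeometry.IsIntegral (affineScheme k S).left :=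
  inferInstanceAs (AlgebraicGeometry.IsIntegral (Spec (.of (AddMonoidAlgebra k S))))

/-- The torus is dense in the toric variety. -/
theorem denseRange_ι_zeroCone [UniqueSums (DualLattice N)] : DenseRange (X.ι k X.zeroCone).left := by
  refine dense_iff_inter_open.mpr fun U hU ⟨x, hx⟩ ↦ ?_
  obtain ⟨σ, y, rfl⟩ := exists_mem_range_ι x
  let j := (inclusionMap k (X.semigroup_mono (X.zeroCone_le σ))).left
  have hj : IsOpenImmersion j := X.isOpenImmersion_map k (homOfLE (X.zeroCone_le σ))
  -- The chart is irreducible, so the open torus in it meets every nonempty open subset.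
  obtain ⟨_, h, ⟨z, rfl⟩⟩ := nonempty_preirreducible_inter
    (hU.preimage (X.ι k σ).left.continuous) j.isOpenEmbedding.isOpen_range ⟨y, hx⟩
    (Set.range_nonempty _)
  refine ⟨_, h, z, ?_⟩
  rw [← X.inclusionMap_ι k (X.zeroCone_le σ)]
  rfl

/-- Reducedness is local on the charts, and the variety is the closure of the irreducible torus. -/
theorem isIntegral_variety [UniqueSums (DualLattice N)] : AlgebraicGeometry.IsIntegral (X.variety k).left := by
  have : IsReduced (X.variety k).left := by
    have (σ : (X.cover k).I₀) : IsReduced ((X.cover k).X σ) :=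
      inferInstanceAs (IsReduced (affineScheme k (X.semigroup σ)).left)
    exact IsReduced.of_openCover _ (X.cover k)
  have : IrreducibleSpace (X.variety k).left := by
    rw [irreducibleSpace_def, Set.top_eq_univ, ← (X.denseRange_ι_zeroCone k).closure_range,
      ← Set.image_univ]
    exact ((IrreducibleSpace.isIrreducible_univ _).image _
      (X.ι k X.zeroCone).left.continuous.continuousOn).closure
  exact isIntegral_of_irreducibleSpace_of_isReduced _

theorem isIntegrallyClosed_stalk_variety [UniqueSums (DualLattice N)] 
    (h : ∀ σ, IsIntegrallyClosed (AddMonoidAlgebra k (X.semigroup σ)))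
    (y : (X.variety k).left) : IsIntegrallyClosed ((X.variety k).left.presheaf.stalk y) := by
  obtain ⟨σ, z, rfl⟩ := exists_mem_range_ι y
  have := h σ
  let z' : PrimeSpectrum (AddMonoidAlgebra k (X.semigroup σ)) := z
  have h1 : IsIntegrallyClosed (Localization.AtPrime z'.asIdeal) :=
    isIntegrallyClosed_of_isLocalization _ z'.asIdeal.primeCompl
      z'.asIdeal.primeCompl_le_nonZeroDivisors
  let e : (X.variety k).left.presheaf.stalk ((X.ι k σ).left z) ≅
      .of (Localization.AtPrime z'.asIdeal) :=
    asIso ((X.ι k σ).left.stalkMap z) ≪≫ Spec.stalkIso (.of (AddMonoidAlgebra k (X.semigroup σ))) z'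
  exact IsIntegrallyClosed.of_equiv e.symm.commRingCatIsoToRingEquiv

variable [Module.Free ℤ N] [Module.Finite ℤ N]

/-- This is what makes the algebras of semigroups in `M` domains. -/
instance uniqueSums_dualLattice : UniqueSums (DualLattice N) :=
  (Module.Free.chooseBasis ℤ (DualLattice N)).repr.toAddEquiv.uniqueSums_iff.mpr inferInstance

/-- The half-spaces are those of the finitely many lattice generators of `σ`. -/
theorem isIntegrallyClosed_saturation (σ : X.cones) :
    IsIntegrallyClosed (AddMonoidAlgebra k (X.saturation.semigroup σ)) := by
  obtain ⟨s, hs⟩ := X.rational σ.1 σ.2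
  refine isIntegrallyClosed_of_halfSpaces k
    ((fun n : N ↦ (Module.Dual.eval ℤ N n).toAddMonoidHom) '' s) fun m ↦ ?_
  change realForm m ∈ dualCone σ.1 ↔ _
  rw [dualCone, hs, PointedCone.dual_hull, Set.forall_mem_image]
  have h1 : ∀ n : N, (0 : ℝ) ≤ realForm m ((1 : ℝ) ⊗ₜ[ℤ] n) ↔ 0 ≤ m n := fun n ↦ by
    rw [realForm_one_tmul, Int.cast_nonneg_iff]
  exact (Set.forall_mem_image (p := fun v ↦ 0 ≤ realForm m v)).trans
    (forall₂_congr fun n _ ↦ h1 n)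

/-- `X` and `X.saturation` have the same cones by definition. This and the next few declarations
phrase the charts of `T_Σ` over the cones of `X`, so that both varieties share one index set. -/
theorem semigroup_le_latticePoints (σ : X.cones) : X.semigroup σ ≤ latticePoints σ.1 :=
  X.semigroup_le_saturation σ

theorem latticePoints_mono {σ τ : X.cones} (h : τ ≤ σ) :
    latticePoints σ.1 ≤ latticePoints τ.1 :=
  X.saturation.semigroup_mono (σ := σ) (τ := τ) h

/-- The inclusion of the chart `T^{σ^∨ ∩ M}` in `T_Σ`. -/
noncomputable def saturationι (σ : X.cones) :
    affineScheme k (latticePoints σ.1) ⟶ X.saturation.variety k :=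
  X.saturation.ι k σ

instance isOpenImmersion_saturationι (σ : X.cones) : IsOpenImmersion (X.saturationι k σ).left :=
  X.saturation.isOpenImmersion_ι k σ

theorem inclusionMap_saturationι {σ τ : X.cones} (h : τ ≤ σ) :
    inclusionMap k (X.latticePoints_mono h) ≫ X.saturationι k σ = X.saturationι k τ :=
  X.saturation.inclusionMap_ι k (σ := σ) (τ := τ) h

theorem saturationι_normalizationMap (σ : X.cones) :
    X.saturationι k σ ≫ X.normalizationMap k =
      inclusionMap k (X.semigroup_le_latticePoints σ) ≫ X.ι k σ :=
  X.ι_normalizationMap k σ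

variable {k} in
theorem exists_mem_range_saturationι (y : (X.saturation.variety k).left) :
    ∃ σ : X.cones, y ∈ Set.range (X.saturationι k σ).left :=
  exists_mem_range_ι (X := X.saturation) y

/-- Both open subcharts are the loci `t^a ≠ 0` for the same `a`, by `IsFaceElement.saturation`. -/
theorem mem_range_inclusionMap_latticePoints {τ ρ : X.cones} (h : ρ ≤ τ)
    {z : (affineScheme k (latticePoints τ.1)).left}
    (hz : (inclusionMap k (X.semigroup_le_latticePoints τ)).left z ∈
      Set.range (inclusionMap k (X.semigroup_mono h)).left) :
    z ∈ Set.range (inclusionMap k (X.latticePoints_mono h)).left := by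
  obtain ⟨a, ha⟩ := X.exists_isFaceElement τ (τ := ρ.1) h
  have ha' := ha.saturation
  refine (mem_range_inclusionMap k (X.latticePoints_mono h) a ha'.mem
    (IsFaceElement.neg_mem X.saturation (τ := ρ) h ha')
    (fun _ hm ↦ IsFaceElement.exists_add_mem X.saturation (τ := ρ) h ha' hm) z).mpr fun h0 ↦ ?_
  refine (mem_range_inclusionMap k (X.semigroup_mono h) a ha.mem (IsFaceElement.neg_mem X h ha)
    (fun _ hm ↦ IsFaceElement.exists_add_mem X h ha hm) _).mp hz ?_
  let z' : PrimeSpectrum (AddMonoidAlgebra k (latticePoints τ.1)) := z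
  have h1 : AddMonoidAlgebra.mapDomain (AddSubmonoid.inclusion (X.semigroup_le_latticePoints τ))
      (AddMonoidAlgebra.single (⟨a, ha.mem⟩ : X.semigroup τ) (1 : k)) ∈ z'.asIdeal := by
    rw [AddMonoidAlgebra.mapDomain_single]
    exact h0
  exact h1

/-- A point in the chart of `τ` whose image lies in `U_σ` has its image in some `U_ρ` with `ρ ≤ τ`
and `ρ ≤ σ`. It then lies in the chart of `ρ` upstairs, hence in that of `σ`. -/
theorem preimage_normalizationMap (σ : X.cones) :
    (X.normalizationMap k).left ⁻¹ᵁ (X.ι k σ).left.opensRange =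
      (X.saturationι k σ).left.opensRange := by
  refine le_antisymm (fun y hy ↦ ?_) ?_
  · obtain ⟨τ, z, rfl⟩ := X.exists_mem_range_saturationι y
    obtain ⟨w, hw⟩ := hy
    have hz : (X.normalizationMap k).left ((X.saturationι k τ).left z) =
        (X.ι k τ).left ((inclusionMap k (X.semigroup_le_latticePoints τ)).left z) := by
      rw [← Scheme.Hom.comp_apply, ← Over.comp_left, saturationι_normalizationMap]
      rfl
    obtain ⟨ρ, f, g, v, hv, -⟩ :=
      (Scheme.IsLocallyDirected.ι_eq_ι_iff (X.chartSchemes k)).mp (hz.symm.trans hw.symm)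
    obtain ⟨u, rfl⟩ := X.mem_range_inclusionMap_latticePoints k (leOfHom f) ⟨v, hv⟩
    refine ⟨(inclusionMap k (X.latticePoints_mono (leOfHom g))).left u, ?_⟩
    rw [← Scheme.Hom.comp_apply, ← Over.comp_left, ← Scheme.Hom.comp_apply,
      ← Over.comp_left, X.inclusionMap_saturationι k (leOfHom g),
      X.inclusionMap_saturationι k (leOfHom f)]
  · rintro _ ⟨z, rfl⟩
    refine ⟨(inclusionMap k (X.semigroup_le_latticePoints σ)).left z, ?_⟩
    rw [← Scheme.Hom.comp_apply, ← Over.comp_left, ← saturationι_normalizationMap]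
    rfl

/-- Over each chart, normalization is thus the morphism given by `Γ_σ ⊆ σ^∨ ∩ M`, to which
properties local on the target reduce. -/
theorem isPullback_normalizationMap (σ : X.cones) :
    IsPullback (inclusionMap k (X.semigroup_le_latticePoints σ)).left (X.saturationι k σ).left
      (X.ι k σ).left (X.normalizationMap k).left :=
  IsOpenImmersion.isPullback _ _ _ _
    (congrArg Over.Hom.left (X.saturationι_normalizationMap k σ))
    (X.preimage_normalizationMap k σ)

/-- A positive power of each term `r t^m` lies in `k[t^{Γ_σ}]`, and integral elements are closed
under sums. -/
theorem isIntegralHom_inclusionMap_latticePoints (σ : X.cones) :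
    IsIntegralHom (inclusionMap k (X.semigroup_le_latticePoints σ)).left := by
  refine IsIntegralHom.SpecMap_iff.mpr fun x ↦ ?_
  let := (AddMonoidAlgebra.mapDomainAlgHom k k
    (AddSubmonoid.inclusion (X.semigroup_le_latticePoints σ))).toRingHom.toAlgebra
  change _root_.IsIntegral (AddMonoidAlgebra k (X.semigroup σ)) x
  induction x using AddMonoidAlgebra.induction_linear with
  | zero => exact isIntegral_zero
  | add f g hf hg => exact hf.add hg
  | single m r =>
    obtain ⟨d, hd, h⟩ := X.exists_nsmul_mem_of_mem_saturation (σ := σ) m.2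
    refine IsIntegral.of_pow hd ?_
    rw [AddMonoidAlgebra.single_pow]
    have : AddMonoidAlgebra.single (d • m) (r ^ d) =
        algebraMap (AddMonoidAlgebra k (X.semigroup σ)) _
          (AddMonoidAlgebra.single ⟨d • m.1, h⟩ (r ^ d)) := by
      refine Eq.trans ?_ AddMonoidAlgebra.mapDomain_single.symm
      rfl
    rw [this]
    exact isIntegral_algebraMap

theorem isIntegralHom_normalizationMap : IsIntegralHom (X.normalizationMap k).left := by
  have (σ : X.cones) :
      IsIntegralHom (Limits.pullback.snd (X.normalizationMap k).left (X.ι k σ).left) := by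
    have := X.isIntegralHom_inclusionMap_latticePoints k σ
    rw [← (X.isPullback_normalizationMap k σ).flip.isoPullback_inv_snd]
    infer_instance
  have h : IsZariskiLocalAtTarget @IsIntegralHom.{u} :=
    @HasAffineProperty.instIsZariskiLocalAtTarget _ _ IsIntegralHom.hasAffineProperty
  exact IsZariskiLocalAtTarget.of_openCover (X.cover k) this

/-- The semigroup of the zero cone is already `M`, so saturating it changes nothing; this gives
birationality. -/
theorem isIso_inclusionMap_zeroCone :
    IsIso (inclusionMap k (X.semigroup_le_latticePoints X.zeroCone)).left := by
  have h : latticePoints X.zeroCone.1 ≤ X.semigroup X.zeroCone := by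
    rw [X.semigroup_zeroCone]
    exact le_top
  have : IsIso (inclusionMap k (X.semigroup_le_latticePoints X.zeroCone)) :=
    ⟨inclusionMap k h, by rw [inclusionMap_comp, inclusionMap_refl],
      by rw [inclusionMap_comp, inclusionMap_refl]⟩
  exact inferInstanceAs (IsIso ((Over.forget _).map
    (inclusionMap k (X.semigroup_le_latticePoints X.zeroCone))))

theorem isNormalization_normalizationMap : IsNormalization (X.normalizationMap k).left where
  isIntegral := X.saturation.isIntegral_variety k
  isIntegrallyClosed := X.saturation.isIntegrallyClosed_stalk_variety k
    (X.isIntegrallyClosed_saturation k)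
  isIntegralHom := X.isIntegralHom_normalizationMap k
  birational := by
    refine ⟨(X.ι k X.zeroCone).left.opensRange, X.denseRange_ι_zeroCone k, ?_, ?_⟩
    · rw [preimage_normalizationMap]
      exact X.saturation.denseRange_ι_zeroCone k
    · have h1 := X.isIso_inclusionMap_zeroCone k
      have h2 : IsIso (Limits.pullback.snd (X.normalizationMap k).left
          (X.ι k X.zeroCone).left) := by
        rw [← (X.isPullback_normalizationMap k X.zeroCone).flip.isoPullback_inv_snd]
        infer_instance
      exact ((MorphismProperty.isomorphisms Scheme).arrow_mk_iso_iff
        (morphismRestrictOpensRange (X.normalizationMap k).left (X.ι k X.zeroCone).left)).mpr h2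

end FanWithSemigroups

end Normalization

end ToricSemigroup

namespace ToricSemigroup

/-! ### Lifting toric morphisms to normalizations -/

section Lifting

variable {k : Type u} [Field k] {N N' : Type u} [AddCommGroup N] [Module.Free ℤ N]
  [Module.Finite ℤ N] [AddCommGroup N'] [Module.Free ℤ N'] [Module.Finite ℤ N']
  {X : FanWithSemigroups N} {X' : FanWithSemigroups N'}

namespace FanWithSemigroups

/-- Normalization is natural for toric morphisms. -/
theorem comp_normalizationMap {φs : N' →ₗ[ℤ] N} (h : IsMapOfFans φs X' X)
    {f : X'.variety k ⟶ X.variety k} (hf : IsInduced k φs f)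
    {ψ : X'.saturation.variety k ⟶ X.saturation.variety k} (hψ : IsInduced k φs ψ) :
    ψ ≫ X.normalizationMap k = X'.normalizationMap k ≫ f := by
  have key (σ' : X'.cones) : X'.saturationι k σ' ≫ ψ ≫ X.normalizationMap k =
      X'.saturationι k σ' ≫ X'.normalizationMap k ≫ f := by
    -- On this chart both composites are given by `φ^*` as a homomorphism from `Γ_σ` to `σ'^∨ ∩ M'`.
    obtain ⟨σ, hσ⟩ := h σ'
    have hσ' := dualMap_mem_latticePoints hσ
    have h1 : X'.saturationι k σ' ≫ ψ = affineMap k (restrictDual φs hσ') ≫ X.saturationι k σ :=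
      hψ σ' σ hσ'
    rw [← Category.assoc, h1, Category.assoc, saturationι_normalizationMap,
      ← Category.assoc (X'.saturationι k σ'), saturationι_normalizationMap, Category.assoc,
      hf σ' σ hσ, ← Category.assoc, ← Category.assoc, inclusionMap, inclusionMap, affineMap_comp, affineMap_comp]
    rfl
  exact X'.saturation.variety_hom_ext k key

end FanWithSemigroups

end Lifting

end ToricSemigroup

/-! ### The main theorem -/

theorem mainTheorem7 {k : Type u} [Field k]
    {N N' : Type u} [AddCommGroup N] [Module.Free ℤ N] [Module.Finite ℤ N]
    [AddCommGroup N'] [Module.Free ℤ N'] [Module.Finite ℤ N']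
    (X : FanWithSemigroups N) (X' : FanWithSemigroups N')
    (φ : torus k N' ⟶ torus k N) [IsMonHom φ] :
    (∃! φs : N' →ₗ[ℤ] N, ToricSemigroup.torusMap k φs = φ) ∧
    ∀ φs : N' →ₗ[ℤ] N, ToricSemigroup.torusMap k φs = φ →
      (IsMapOfFans φs X' X →
        (∃! f : X'.variety k ⟶ X.variety k, IsInduced k φs f) ∧
        ∀ f : X'.variety k ⟶ X.variety k, IsInduced k φs f → Extends φ f ∧ IsEquivariant φ f) ∧
      (∀ f : X'.variety k ⟶ X.variety k, Extends φ f → IsEquivariant φ f →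
        IsMapOfFans φs X' X ∧ IsInduced k φs f) ∧
      IsNormalization (X'.normalizationMap k).left ∧
      IsNormalization (X.normalizationMap k).left ∧
      (∀ f : X'.variety k ⟶ X.variety k, Extends φ f → IsEquivariant φ f →
        (∃! ψ : X'.saturation.variety k ⟶ X.saturation.variety k,
          Extends φ ψ ∧ IsEquivariant φ ψ) ∧
        ∀ ψ : X'.saturation.variety k ⟶ X.saturation.variety k,
          Extends φ ψ → IsEquivariant φ ψ →
            ψ ≫ X.normalizationMap k = X'.normalizationMap k ≫ f) := by
  refine ⟨existsUnique_torusMap_eq k φ, ?_⟩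
  rintro φs rfl
  refine ⟨fun h ↦ ⟨FanWithSemigroups.existsUnique_isInduced h, fun f hf ↦
      ⟨hf.extends h, hf.isEquivariant h⟩⟩,
    fun f he hf ↦ FanWithSemigroups.isMapOfFans_and_isInduced he hf,
    X'.isNormalization_normalizationMap k, X.isNormalization_normalizationMap k,
    fun f he hf ↦ ?_⟩
  obtain ⟨h, hi⟩ := FanWithSemigroups.isMapOfFans_and_isInduced he hf
  refine ⟨?_, fun ψ he' hf' ↦ FanWithSemigroups.comp_normalizationMap h hi
    (FanWithSemigroups.isMapOfFans_and_isInduced he' hf').2⟩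
  -- The induced morphism of the saturated triples is the lift. It is unique because the converse,
  -- applied to those triples, makes every equivariant extension induced.
  obtain ⟨ψ, hψ, hu⟩ := FanWithSemigroups.existsUnique_isInduced (k := k) h.saturation
  exact ⟨ψ, ⟨hψ.extends h.saturation, hψ.isEquivariant h.saturation⟩, fun ψ' h' ↦
    hu ψ' (FanWithSemigroups.isMapOfFans_and_isInduced h'.1 h'.2).2⟩
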